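/- A \emph{deterministic two-party Watson-Crick system} over a finite input alphabet $\Sigma$ consists of a finite set $M$ of messages, endmarkers $\vartriangleright,\vartriangleleft\notin\Sigma$, and two finite-state components $A_1$ (upper) and $A_2$ (lower). Each $A_i$ has a finite state set $Q_i$, an initial state, a set of accepting states, a broadcast function $\mu_i:Q_i\times(\Sigma\cup\{\vartriangleright,\vartriangleleft\})\to M\cup\{\bot\}$ ($\bot$ means that nothing is sent) and a partial transition function $\delta_i:Q_i\times(\Sigma\cup\{\vartriangleright,\vartriangleleft\})\times(M\cup\{\bot\})\to Q_i\times\{0,+\}$. On input $w=a_1\cdots a_n$ the tape is $a_0a_1\cdots a_na_{n+1}$ with $a_0=\vartriangleright$, $a_{n+1}=\vartriangleleft$; the upper head starts at position $0$ and the lower head at position $n+1$. If $A_1$ is in state $p$ at position $i$ and $A_2$ in state $q$ at position $j$, then the system makes the step given by $\delta_1(p,a_i,\mu_2(q,a_j))=(p_1,d_1)$ and $\delta_2(q,a_j,\mu_1(p,a_i))=(q_1,d_2)$ to the states $p_1,q_1$ and positions $i+d_1$, $j-d_2$ (with $+$ read as $1$), and it halts if there is no such successor configuration with both positions in $\{0,\dots,n+1\}$.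 The input is accepted if the computation halts with at least one component in an accepting state. The system is \emph{reversible} (a $\textrm{REV-PWK}$) if every configuration (on every input) has at most one predecessor, and there are reverse broadcast functions $\mu_i^{\leftarrow}:Q_i\times(\Sigma\cup\{\vartriangleright,\vartriangleleft\})\to M\cup\{\bot\}$ and partial reverse transition functions $\delta_i^{\leftarrow}:Q_i\times(\Sigma\cup\{\vartriangleright,\vartriangleleft\})\times(M\cup\{\bot\})\to Q_i\times\{0,-\}$ that induce exactly the converse of the step relation, where in a reverse step the heads move first (the upper one to the left, the lower one to the right, or not at all) and the symbols are read at the new positions. It is a $\textrm{REV-PWK}(O(n))$ if, for some such reverse functions and some $f:\mathbb N\to\mathbb N$ with $f\in O(n)$, every accepted word $w$ is accepted by a computation in which at most $f(|w|)$ messages (different from $\bot$) are sent in total, and in whose reversal, too, at most $f(|w|)$ messages are sent in total. \textbf{Theorem.} The problems of testing emptiness, finiteness, inclusion, and equivalence are not semidecidable for given $\textrm{REV-PWK}(O(n))$s. That is, each of the following is impossible: an algorithm that, given the description (by the full tables of its functions) of an arbitrary $\textrm{REV-PWK}(O(n))$ $\mathcal A$, halts if and only if $L(\mathcal A)=\emptyset$;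 an algorithm that, given such an $\mathcal A$, halts if and only if $L(\mathcal A)$ is finite; an algorithm that, given two arbitrary $\textrm{REV-PWK}(O(n))$s $\mathcal A,\mathcal B$ over the same input alphabet, halts if and only if $L(\mathcal A)\subseteq L(\mathcal B)$; an algorithm that, given two such $\mathcal A,\mathcal B$, halts if and only if $L(\mathcal A)=L(\mathcal B)$. (Nothing is required of these algorithms on other inputs.) -/

import Mathlib

/-- A tape symbol: an input symbol, or one of the two endmarkers. -/
inductive TapeSymbol (σ : Type) where
  | leftEnd : TapeSymbol σ
  | rightEnd : TapeSymbol σ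
  | sym (a : σ) : TapeSymbol σ

/-- A head movement: stay on the current square, or move by one square (in the direction that is
fixed for the component and for the direction of time). -/
inductive Move where
  | stay : Move
  | advance : Move

/-- The number of squares moved. -/
def Move.toNat : Move → ℕ
  | .stay => 0
  | .advance => 1

/-- A broadcast function and a partial transition function of one component. The message `none` is
"nothing to send"; the value `none` of `trans` means "undefined". -/
structure Rule (σ M Q : Type) where
  broadcast : Q → TapeSymbol σ → Option M
  trans : Q → TapeSymbol σ → Option M → Option (Q × Move)

/-- One component of a two-party Watson-Crick system. -/
structure Component (σ M Q : Type) extends Rule σ M Q where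
  start : Q
  accept : Finset Q

/-- A deterministic two-party Watson-Crick system with `s` input symbols. Its (finite) sets of
messages and of states are `Fin numMsg`, `Fin numUpper` and `Fin numLower`. -/
structure DPWK (s : ℕ) where
  numMsg : ℕ
  numUpper : ℕ
  numLower : ℕ
  upper : Component (Fin s) (Fin numMsg) (Fin numUpper)
  lower : Component (Fin s) (Fin numMsg) (Fin numLower)

/-- The symbol `a_i` of the inscription `a_0 a_1 ⋯ a_n a_{n+1}` of the tape for the input
`w = a_1 ⋯ a_n`, where `a_0` and `a_{n+1}` are the left and the right endmarker. -/
def tapeAt {σ : Type} (w : List σ) (i : Fin (w.length + 2)) : TapeSymbol σ :=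
  if i.val = 0 then .leftEnd
  else if h : i.val - 1 < w.length then .sym w[i.val - 1]
  else .rightEnd

/-- States and head positions of the two components; the positions are `0, …, n + 1` for an input
of length `n`. -/
@[ext]
structure Config (Q₁ Q₂ : Type) (n : ℕ) where
  state₁ : Q₁
  pos₁ : Fin (n + 2)
  state₂ : Q₂
  pos₂ : Fin (n + 2)

/-- If the upper component is in state `p` reading `x` and the lower one is in state `q` reading
`y`, then they exchange their messages, and the transition functions yield `(p', d₁)` and
`(q', d₂)`. -/
def JointStep {σ M Q₁ Q₂ : Type} (R₁ : Rule σ M Q₁) (R₂ : Rule σ M Q₂)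
    (p : Q₁) (x : TapeSymbol σ) (q : Q₂) (y : TapeSymbol σ)
    (p' : Q₁) (d₁ : Move) (q' : Q₂) (d₂ : Move) : Prop :=
  R₁.trans p x (R₂.broadcast q y) = some (p', d₁) ∧
  R₂.trans q y (R₁.broadcast p x) = some (q', d₂)

/-- The number of messages (0, 1 or 2) that the two components send at the same time. -/
def messagesSent {σ M Q₁ Q₂ : Type} (R₁ : Rule σ M Q₁) (R₂ : Rule σ M Q₂)
    (p : Q₁) (x : TapeSymbol σ) (q : Q₂) (y : TapeSymbol σ) : ℕ :=
  (if (R₁.broadcast p x).isSome then 1 else 0) + (if (R₂.broadcast q y).isSome then 1 else 0)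

/-- `WeightedRun step cost a b k`: there is a finite sequence of steps from `a` to `b` whose costs
add up to `k`. -/
inductive WeightedRun {C : Type} (step : C → C → Prop) (cost : C → C → ℕ) : C → C → ℕ → Prop where
  | refl (a : C) : WeightedRun step cost a a 0
  | tail {a b c : C} {k : ℕ} :
      WeightedRun step cost a b k → step b c → WeightedRun step cost a c (k + cost b c)

namespace DPWK

variable {s : ℕ}

/-- The configurations of a system on the input `w`. -/
abbrev Conf (A : DPWK s) (w : List (Fin s)) : Type :=
  Config (Fin A.numUpper) (Fin A.numLower) w.length

/-- The initial configuration: the upper head is on the left endmarker, the lower head is on the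
right endmarker. -/
def init (A : DPWK s) (w : List (Fin s)) : A.Conf w where
  state₁ := A.upper.start
  pos₁ := 0
  state₂ := A.lower.start
  pos₂ := Fin.last (w.length + 1)

/-- One step. The upper head moves to the right, the lower head moves to the left. A step that
would take a head off the tape is not possible. -/
def Step (A : DPWK s) (w : List (Fin s)) (c c' : A.Conf w) : Prop :=
  ∃ d₁ d₂ : Move,
    JointStep A.upper.toRule A.lower.toRule c.state₁ (tapeAt w c.pos₁) c.state₂ (tapeAt w c.pos₂)
      c'.state₁ d₁ c'.state₂ d₂ ∧
    c'.pos₁.val = c.pos₁.val + d₁.toNat ∧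
    c'.pos₂.val + d₂.toNat = c.pos₂.val

/-- A configuration is halting if it has no successor. -/
def Halting (A : DPWK s) (w : List (Fin s)) (c : A.Conf w) : Prop :=
  ∀ c', ¬ A.Step w c c'

/-- At least one component is in an accepting state. -/
def Accepting (A : DPWK s) (w : List (Fin s)) (c : A.Conf w) : Prop :=
  c.state₁ ∈ A.upper.accept ∨ c.state₂ ∈ A.lower.accept

/-- The accepted language. -/
def language (A : DPWK s) : Set (List (Fin s)) :=
  {w | ∃ c, Relation.ReflTransGen (A.Step w) (A.init w) c ∧ A.Halting w c ∧ A.Accepting w c}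

/-- The messages sent in a configuration. -/
def messages (A : DPWK s) (w : List (Fin s)) (c : A.Conf w) : ℕ :=
  messagesSent A.upper.toRule A.lower.toRule c.state₁ (tapeAt w c.pos₁) c.state₂ (tapeAt w c.pos₂)

/-- Reverse broadcast functions and reverse transition functions for both components. -/
structure ReverseRules (A : DPWK s) where
  upper : Rule (Fin s) (Fin A.numMsg) (Fin A.numUpper)
  lower : Rule (Fin s) (Fin A.numMsg) (Fin A.numLower)

/-- One reverse step, from `c'` to its predecessor `c`. The heads move first (the upper one to the
left, the lower one to the right), and the input symbols are read at the new positions. -/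
def RevStep (A : DPWK s) (R : A.ReverseRules) (w : List (Fin s)) (c' c : A.Conf w) : Prop :=
  ∃ d₁ d₂ : Move,
    JointStep R.upper R.lower c'.state₁ (tapeAt w c.pos₁) c'.state₂ (tapeAt w c.pos₂)
      c.state₁ d₁ c.state₂ d₂ ∧
    c.pos₁.val + d₁.toNat = c'.pos₁.val ∧
    c.pos₂.val = c'.pos₂.val + d₂.toNat

/-- The messages sent in the reverse step from `c'` to `c`. -/
def revMessages (A : DPWK s) (R : A.ReverseRules) (w : List (Fin s)) (c' c : A.Conf w) : ℕ :=
  messagesSent R.upper R.lower c'.state₁ (tapeAt w c.pos₁) c'.state₂ (tapeAt w c.pos₂)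

/-- The system is backward deterministic, and `R` induces exactly the converse of its step
relation, on all configurations. -/
def IsReversedBy (A : DPWK s) (R : A.ReverseRules) : Prop :=
  (∀ (w : List (Fin s)) (c₁ c₂ c' : A.Conf w), A.Step w c₁ c' → A.Step w c₂ c' → c₁ = c₂) ∧
  (∀ (w : List (Fin s)) (c c' : A.Conf w), A.RevStep R w c' c ↔ A.Step w c c')

/-- Every accepted word `w` is accepted by a computation in which at most `f |w|` messages are sent
(those of the halting configuration included), and in whose reversal, computed by `R`, at most
`f |w|` messages are sent. -/
def CommunicationBounded (A : DPWK s) (R : A.ReverseRules) (f : ℕ → ℕ) : Prop :=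
  ∀ w ∈ A.language, ∃ (c : A.Conf w) (k k' : ℕ),
    A.Halting w c ∧ A.Accepting w c ∧
    WeightedRun (A.Step w) (fun b _ => A.messages w b) (A.init w) c k ∧
    k + A.messages w c ≤ f w.length ∧
    WeightedRun (A.RevStep R w) (A.revMessages R w) c (A.init w) k' ∧
    k' ≤ f w.length

/-- The system is reversible and communication bounded by some function in `O(n)`. -/
def IsLinearREV (A : DPWK s) : Prop :=
  ∃ (R : A.ReverseRules) (f : ℕ → ℕ), A.IsReversedBy R ∧
    Asymptotics.IsBigO Filter.atTop (fun n : ℕ => (f n : ℝ)) (fun n : ℕ => (n : ℝ)) ∧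
    A.CommunicationBounded R f

end DPWK

/-- Descriptions of components: number of states, initial state, accepting states, table of the
broadcast function, table of the transition function. -/
abbrev ComponentCode : Type :=
  ℕ × ℕ × List Bool × List (List (Option ℕ)) × List (List (List (Option (ℕ × ℕ))))

/-- Descriptions of systems: number of input symbols, number of messages, the two components. -/
abbrev DPWKCode : Type := ℕ × ℕ × ComponentCode × ComponentCode

/-- All tape symbols over `s` input symbols. -/
def allTapeSymbols (s : ℕ) : List (TapeSymbol (Fin s)) :=
  .leftEnd :: .rightEnd :: (List.finRange s).map .sym

/-- All messages, "nothing to send" included. -/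
def allMessages (m : ℕ) : List (Option (Fin m)) :=
  none :: (List.finRange m).map some

/-- The description of a component by the full tables of its functions. -/
def Component.code {s m k : ℕ} (B : Component (Fin s) (Fin m) (Fin k)) : ComponentCode :=
  (k, B.start.val,
    (List.finRange k).map fun q => decide (q ∈ B.accept),
    (List.finRange k).map fun q => (allTapeSymbols s).map fun x =>
      (B.broadcast q x).map fun a => a.val,
    (List.finRange k).map fun q => (allTapeSymbols s).map fun x => (allMessages m).map fun a =>
      (B.trans q x a).map fun r => (r.1.val, r.2.toNat))

/-- The description of a system, which is the form in which an algorithm receives it. -/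
def DPWK.code {s : ℕ} (A : DPWK s) : DPWKCode :=
  (s, A.numMsg, A.upper.code, A.lower.code)

/-- The problem whether an object of the class `inst` has the property `yes` is semidecidable: there
is an algorithm that, given the description of any object of the class, halts if and only if the
object has the property. (Nothing is required on other inputs.) -/
def SemidecidableOn {α ι : Type} [Primcodable ι] (code : α → ι) (inst yes : α → Prop) : Prop :=
  ∃ P : ι → Prop, REPred P ∧ ∀ a, inst a → (P (code a) ↔ yes a)

/-! The complement of the halting problem is not semidecidable. It therefore suffices to have a
computable family of reversible systems with linear communication whose n-th language is infinite if
the n-th partial recursive function is defined at 0, and empty otherwise (`exists_family_DPWK`).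
Emptiness and finiteness then both express non-halting, and so do inclusion in and equality with a
fixed system for the empty language.

Halting is first moved to a queue machine with fixed rules and a unary input of length n + 1
(`exists_queueMachine_dom`), so that n affects a system only through the length of a chain of
states. In a queue computation the removed letters followed by the final queue spell the initial
queue followed by all written letters. A halting computation is thus a list l of rules that
satisfies this one equation and leads from the initial state to halting.

An accepted word has three blocks. The first is this stream of letters, each with the state in which
it is removed (`none` for the final queue); after a separator, the second repeats l in reverse
order; the third is padding. The upper head counts off the n + 1 input letters. It then compares the
rest of the stream with the letters written by the rules, which the lower head, coming from the
right, meets in their original order. Both heads reach the separator together. The lower head skips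
the final queue; then both heads read l from its last rule to its first, comparing the two copies
and checking the path of states backwards. Acceptance implies halting by `eval_dom_of_spec`;
conversely `exists_accepts` gives a history for every nonzero amount of padding, hence an infinite
language.

For reversibility, the next state is an injective function of the state for each fixed pair of
symbols, and the head moves are determined by the state entered. Each step advances a head, so there
are linearly many steps and both components can afford to broadcast every symbol they read. -/

/-! ### The halting problem for a finite Turing machine on unary inputs -/

/-- The number with binary expansion `1…1` of length `n + 1`. -/
def binaryOnes : ℕ → PosNum
  | 0 => .one
  | n + 1 => .bit1 (binaryOnes n)

-- The stack machine reads numbers in binary; the numbers 2 ^ (n + 1) - 1 are used because their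
-- encoding varies only in length.
open Turing PartrecToTM2 in
theorem trNat_binaryOnes (n : ℕ) :
    trNat (binaryOnes n : ℕ) = List.replicate (n + 1) Γ'.bit1 := by
  have h : ((binaryOnes n : ℕ) : Num) = Num.pos (binaryOnes n) :=
    Num.of_to_nat (Num.pos (binaryOnes n))
  rw [trNat, h, trNum]
  clear h
  induction n with
  | zero => rfl
  | succ n ih => rw [binaryOnes, trPosNum, ih]; rfl

theorem cast_binaryOnes (n : ℕ) : (binaryOnes n : ℕ) + 1 = 2 ^ (n + 1) := by
  induction n with
  | zero => rfl
  | succ n ih =>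
    rw [binaryOnes, PosNum.cast_bit1, pow_succ, ← ih]
    ring

theorem computable_binaryOnes : Computable fun n => (binaryOnes n : ℕ) := by
  have h : Primrec fun n : ℕ => 2 ^ (n + 1) - 1 :=
    Primrec.nat_sub.comp
      ((Primrec₂.unpaired'.1 Nat.Primrec.pow).comp (Primrec.const 2) Primrec.succ)
      (Primrec.const 1)
  exact (h.of_eq fun n => by rw [← cast_binaryOnes, Nat.add_sub_cancel]).to_comp

/-- A partial recursive function that decides the halting problem on the numbers `1…1`. -/
theorem exists_partrec_dom_binaryOnes :
    ∃ f : ℕ →. ℕ, Partrec f ∧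
      ∀ n, (f (binaryOnes n)).Dom ↔ ((Denumerable.ofNat Nat.Partrec.Code n).eval 0).Dom := by
  let p : ℕ → ℕ →. Bool := fun m n => (Part.some (decide ((binaryOnes n : ℕ) = m)) : Part Bool)
  -- The unbounded search recovers `n` from `1…1`; it diverges on all other numbers, which are
  -- irrelevant.
  let g : ℕ →. ℕ := fun m => Nat.rfind (p m)
  have hp : Partrec₂ p := by
    have : Computable₂ fun m n : ℕ => decide ((binaryOnes n : ℕ) = m) :=
      (Primrec.eq (α := ℕ)).decide.to_comp.comp
        (computable_binaryOnes.comp Computable.snd) Computable.fst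
    exact this.partrec₂
  have hg : Partrec g := Partrec.rfind hp
  refine ⟨fun m => (g m).bind fun n => (Denumerable.ofNat Nat.Partrec.Code n).eval 0,
    hg.bind (Nat.Partrec.Code.eval_part.comp ((Computable.ofNat _).comp Computable.snd)
      (Computable.const 0)), fun n => ?_⟩
  have h : n ∈ g (binaryOnes n) := by
    refine Nat.mem_rfind.2 ⟨by simp [p], fun {m} hm => ?_⟩
    have : (binaryOnes m : ℕ) ≠ binaryOnes n := fun e => by
      have h1 := cast_binaryOnes m
      rw [e, cast_binaryOnes] at h1
      have := Nat.pow_right_injective le_rfl h1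
      omega
    simpa [p] using this
  change ((g (binaryOnes n)).bind _).Dom ↔ _
  have hb := Part.bind_some n fun n => (Denumerable.ofNat Nat.Partrec.Code n).eval 0
  rw [← Part.eq_some_iff.2 h] at hb
  rw [hb]

open Turing in
/-- A stack machine with a finite support is simulated by a Turing machine with finitely many
states. -/
theorem exists_finite_TM0 {K : Type} [DecidableEq K] [Fintype K] {Γ : K → Type}
    [∀ k, Fintype (Γ k)] {Λ σ : Type} [Inhabited Λ] [Inhabited σ] [Fintype σ]
    (M : Λ → TM2.Stmt Γ Λ σ) {S₂ : Finset Λ} (hM : TM2.Supports M S₂) :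
    ∃ (Λ₀ : Type) (_ : Finite Λ₀) (_ : Inhabited Λ₀) (M₀ : TM0.Machine (TM2to1.Γ' K Γ) Λ₀),
      ∀ k L, (StateTransition.eval (TM0.step M₀) (TM0.init (TM2to1.trInit k L))).Dom ↔
        (StateTransition.eval (TM2.step M) (TM2.init k L)).Dom := by
  let M₁ := TM1to0.tr (TM2to1.tr M)
  have hs := TM1to0.tr_supports _ (TM2to1.tr_supports _ hM)
  let S := TM1to0.trStmts (TM2to1.tr M) (TM2to1.trSupp M S₂)
  let Λ₀ := {q // q ∈ S}
  let _ : Inhabited Λ₀ := ⟨⟨default, hs.1⟩⟩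
  classical
  -- States outside the finite support are never reached, so they may be sent to the default state.
  let g₁ : PointedMap _ Λ₀ := ⟨fun q => if h : q ∈ S then ⟨q, h⟩ else default, dif_pos hs.1⟩
  have hg : ∀ q ∈ (S : Set _), Subtype.val (g₁ q) = q := fun q hq => by
    change Subtype.val (if h : q ∈ S then (⟨q, h⟩ : Λ₀) else default) = q
    rw [dif_pos (by exact hq)]
  let idp : PointedMap (TM2to1.Γ' K Γ) (TM2to1.Γ' K Γ) := ⟨id, rfl⟩
  have resp := TM0.Machine.map_respects M₁ idp idp g₁ Subtype.val hs (fun _ => rfl) hg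
  refine ⟨Λ₀, inferInstance, inferInstance, M₁.map idp idp g₁ Subtype.val, fun k L => ?_⟩
  have h1 := StateTransition.tr_eval_dom resp (a₁ := TM0.init (TM2to1.trInit k L)) ⟨hs.1, rfl⟩
  have h2 := TM2to1.tr_eval_dom M k L
  rw [TM0.map_init] at h1
  have hid : List.map idp (TM2to1.trInit k L) = TM2to1.trInit k L := List.map_id _
  rw [hid] at h1
  rw [← TM1to0.tr_eval] at h2
  exact h1.trans h2

open Turing in
/-- A Turing machine with finitely many states and symbols whose halting problem on the
inputs `b₀ b ⋯ b` is the halting problem for partial recursive functions. -/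
theorem exists_turingMachine_dom :
    ∃ (Γ Λ : Type) (_ : Finite Γ) (_ : Finite Λ) (_ : Inhabited Γ) (_ : Inhabited Λ)
      (M : TM0.Machine Γ Λ) (b₀ b : Γ), ∀ n,
      (StateTransition.eval (TM0.step M) (TM0.init (b₀ :: List.replicate (n + 1) b))).Dom ↔
        ((Denumerable.ofNat Nat.Partrec.Code n).eval 0).Dom := by
  obtain ⟨f, hf, hdom⟩ := exists_partrec_dom_binaryOnes
  obtain ⟨c, hc⟩ := ToPartrec.Code.exists_code (Nat.Partrec'.part_iff₁.2 hf)
  let _ : Inhabited PartrecToTM2.Λ' := ⟨PartrecToTM2.trNormal c .halt⟩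
  let _ : Fintype PartrecToTM2.K' := ⟨{.main, .rev, .aux, .stack}, fun k => by cases k <;> simp⟩
  obtain ⟨Λ, hΛ, hΛ', M, hM⟩ :=
    exists_finite_TM0 _ (PartrecToTM2.tr_supports c PartrecToTM2.Cont'.halt)
  refine ⟨TM2to1.Γ' PartrecToTM2.K' fun _ => PartrecToTM2.Γ', Λ, Finite.of_fintype _, hΛ,
    inferInstance, hΛ', M,
    (true, Function.update (fun _ => none) PartrecToTM2.K'.main (some PartrecToTM2.Γ'.cons)),
    (false, Function.update (fun _ => none) PartrecToTM2.K'.main (some PartrecToTM2.Γ'.bit1)),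
    fun n => ?_⟩
  have h := hM PartrecToTM2.K'.main (PartrecToTM2.trList [(binaryOnes n : ℕ)])
  -- The encoded list ends with `cons` and `trInit` reverses the stack, so the bottom symbol,
  -- flagged `true`, comes first.
  have hl : TM2to1.trInit PartrecToTM2.K'.main (PartrecToTM2.trList [(binaryOnes n : ℕ)]) =
      (true, Function.update (fun _ => none) PartrecToTM2.K'.main (some PartrecToTM2.Γ'.cons)) ::
        List.replicate (n + 1) (false,
          Function.update (fun _ => none) PartrecToTM2.K'.main (some PartrecToTM2.Γ'.bit1)) := by
    rw [PartrecToTM2.trList, PartrecToTM2.trList, trNat_binaryOnes, TM2to1.trInit]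
    simp only [List.reverse_append, List.reverse_cons, List.reverse_nil, List.nil_append,
      List.reverse_replicate, List.singleton_append]
    exact congrArg (_ :: ·) List.map_replicate
  rw [hl] at h
  refine h.trans ?_
  have h3 := PartrecToTM2.tr_eval c [(binaryOnes n : ℕ)]
  have h4 := hc ⟨[(binaryOnes n : ℕ)], rfl⟩
  change c.eval [(binaryOnes n : ℕ)] = _ at h4
  rw [h4] at h3
  have hinit : PartrecToTM2.init c [(binaryOnes n : ℕ)] =
      TM2.init PartrecToTM2.K'.main (PartrecToTM2.trList [(binaryOnes n : ℕ)]) := by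
    unfold PartrecToTM2.init TM2.init
    congr 1
    funext k
    cases k <;> rfl
  rw [hinit] at h3
  exact (iff_of_eq (congrArg Part.Dom h3)).trans (hdom n)

/-! ### Queue machines and their computations as lists of rules -/

/-- The rules of a queue machine: in the state `s` with the letter `a` at the front of the queue,
`a` is removed and one or two letters are appended to the end; `none` is the halting state. -/
abbrev QueueRules (S A : Type) : Type := S → A → A × Option A × Option S

namespace QueueRules

variable {S A : Type} (δ : QueueRules S A)

/-- The letters appended by a rule. -/
def written (r : S × A) : List A := (δ r.1 r.2).1 :: (δ r.1 r.2).2.1.toList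

/-- The state reached by a rule. -/
def target (r : S × A) : Option S := (δ r.1 r.2).2.2

/-- One step of a queue machine. -/
def step : S × List A → Option (S × List A)
  | (_, []) => none
  | (s, a :: q) => (δ.target (s, a)).map fun s' => (s', q ++ δ.written (s, a))

/-- The rules of the list lead from one state to another. -/
def Path : Option S → List (S × A) → Option S → Prop
  | o, [], o' => o = o'
  | o, r :: l, o' => o = some r.1 ∧ Path (δ.target r) l o'

theorem path_append_singleton (o o' : Option S) (l : List (S × A)) (r : S × A) :
    δ.Path o (l ++ [r]) o' ↔ δ.Path o l (some r.1) ∧ δ.target r = o' := by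
  induction l generalizing o with
  | nil => simp [Path]
  | cons r' l ih => simp [Path, ih, and_assoc]

/-- The right side of `hl` lists all letters ever in the queue, in order of arrival. The rules
consume a prefix of it, so each finds its letter at the front. -/
theorem eval_dom_of_path (l : List (S × A)) (s : S) (q e : List A) (hq : q ≠ [])
    (hp : δ.Path (some s) l none) (hl : l.map Prod.snd ++ e = q ++ l.flatMap δ.written) :
    (StateTransition.eval δ.step (s, q)).Dom := by
  induction l generalizing s q with
  | nil => simp [Path] at hp
  | cons r l ih =>
    obtain ⟨a, q, rfl⟩ := List.exists_cons_of_ne_nil hq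
    obtain ⟨s', a'⟩ := r
    obtain ⟨h1, h2⟩ := hp
    obtain rfl : s = s' := by simpa using h1
    simp only [List.map_cons, List.cons_append, List.flatMap_cons, List.cons.injEq] at hl
    obtain ⟨rfl, hl⟩ := hl
    cases ht : δ.target (s, a') with
    | none =>
      exact Part.dom_iff_mem.2 ⟨_, StateTransition.mem_eval.2
        ⟨Relation.ReflTransGen.refl, by simp [step, ht]⟩⟩
    | some s' =>
      rw [ht] at h2
      rw [StateTransition.reaches_eval (b := (s', q ++ δ.written (s, a')))
        (Relation.ReflTransGen.single (by simp [step, ht]))]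
      exact ih s' _ (by simp [written]) h2 (by rw [hl, List.append_assoc])

theorem exists_path_of_eval_dom (s : S) (q : List A) (hq : q ≠ [])
    (h : (StateTransition.eval δ.step (s, q)).Dom) :
    ∃ l e, δ.Path (some s) l none ∧ l.map Prod.snd ++ e = q ++ l.flatMap δ.written := by
  obtain ⟨c, hc⟩ := Part.dom_iff_mem.1 h
  obtain ⟨hr, hn⟩ := StateTransition.mem_eval.1 hc
  have key : ∀ c', StateTransition.Reaches δ.step c' c → c'.2 ≠ [] →
      ∃ l e, δ.Path (some c'.1) l none ∧ l.map Prod.snd ++ e = c'.2 ++ l.flatMap δ.written := by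
    intro c' hr
    induction hr using Relation.ReflTransGen.head_induction_on with
    | refl =>
      intro hq
      obtain ⟨s, q⟩ := c
      obtain ⟨a, q, rfl⟩ := List.exists_cons_of_ne_nil hq
      -- `step` does not apply the halting rule, but the path contains it, so the letters it writes
      -- are part of the leftover.
      refine ⟨[(s, a)], q ++ δ.written (s, a), ⟨rfl, ?_⟩, by simp⟩
      simpa [step, Path] using hn
    | @head c₁ c₂ hstep _ ih =>
      intro hq
      obtain ⟨s, q⟩ := c₁
      dsimp only at hq
      obtain ⟨a, q, rfl⟩ := List.exists_cons_of_ne_nil hq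
      simp only [step, Option.mem_def, Option.map_eq_some_iff] at hstep
      obtain ⟨s', ht, rfl⟩ := hstep
      obtain ⟨l, e, hl, he⟩ := ih (by simp [written])
      exact ⟨(s, a) :: l, e, ⟨rfl, by rwa [ht]⟩, by simp [he]⟩
  exact key _ hr hq

end QueueRules

/-! ### Simulation of a Turing machine by a queue machine -/

namespace TuringQueue

open Turing QueueRules

variable {Γ Λ : Type} [Inhabited Γ] [Inhabited Λ]

/-- The letters of the queue: a separator, tape symbols, and the symbol under the head together
with the state. -/
abbrev Letter (Γ Λ : Type) : Type := Option (Option Λ × Γ)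

/-- The tape symbol `x` away from the head. -/
abbrev Letter.cell (x : Γ) : Letter Γ Λ := some (none, x)

/-- The tape symbol `x` under the head, in the state `q`. -/
abbrev Letter.head (q : Λ) (x : Γ) : Letter Γ Λ := some (some q, x)

/-- The states of the queue machine: an initial state, and states that hold back one letter and
possibly the state in which the head arrives at the next square. -/
abbrev State (Γ Λ : Type) : Type := Option (Letter Γ Λ × Option Λ)

/-- A queue machine that simulates a Turing machine. The letter held back, followed by the queue,
is a rotation of the configuration of the Turing machine. -/
def rules (M : TM0.Machine Γ Λ) (b₀ : Γ) : QueueRules (State Γ Λ) (Letter Γ Λ)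
  | none, z => (none, some (.head default b₀), some (some (z, none)))
  | some (y, some q), some (_, x) => (y, none, some (some (.head q x, none)))
  | some (y, some q), none => (y, some (.head q default), some (some (none, none)))
  | some (y, none), some (some q, x) =>
    match M q x with
    | none => (y, none, none)
    | some (q', .write a) => (y, none, some (some (.head q' a, none)))
    | some (q', .move .right) => (y, none, some (some (.cell x, some q')))
    | some (q', .move .left) =>
      match y with
      | some (_, x') => (.head q' x', none, some (some (.cell x, none)))
      | none => (none, some (.head q' default), some (some (.cell x, none)))
  | some (y, none), z => (y, none, some (some (z, none)))

/-- The queue machine is about to read the head letter of the given configuration. -/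
def Represents (c : TM0.Cfg Γ Λ) (d : State Γ Λ × List (Letter Γ Λ)) : Prop :=
  ∃ (L R : List Γ) (x : Γ) (y : Letter Γ Λ) (Q : List (Letter Γ Λ)),
    c.Tape = Tape.mk' (ListBlank.mk L) (ListBlank.mk (x :: R)) ∧
    d = (some (y, none), .head c.q x :: Q) ∧
    Q ++ [y] = R.map Letter.cell ++ none :: (L.map Letter.cell).reverse

/-- As long as no head letter is read, the machine only exchanges the held letter for the next one,
which rotates the cyclic word. -/
theorem reaches_rotation (M : TM0.Machine Γ Λ) (b₀ : Γ) (h : Letter Γ Λ)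
    (A : List (Letter Γ Λ)) (hA : ∀ q x, .head q x ∉ A) (y : Letter Γ Λ)
    (B : List (Letter Γ Λ)) :
    ∃ y' Q, StateTransition.Reaches (step (rules M b₀)) (some (y, none), A ++ h :: B)
      (some (y', none), h :: Q) ∧ Q ++ [y'] = B ++ y :: A := by
  induction A generalizing y B with
  | nil => exact ⟨y, B, Relation.ReflTransGen.refl, rfl⟩
  | cons z A ih =>
    obtain ⟨y', Q, h1, h2⟩ := ih (fun q x hm => hA q x (List.mem_cons_of_mem _ hm)) z (B ++ [y])
    refine ⟨y', Q, Relation.ReflTransGen.head ?_ h1, by simpa using h2⟩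
    rcases z with _ | ⟨_ | q, x⟩
    · simp [step, rules, target, written]
    · simp [step, rules, target, written]
    · exact absurd List.mem_cons_self (hA q x)

omit [Inhabited Γ] [Inhabited Λ] in
theorem head_notMem (L R : List Γ) (q : Λ) (x : Γ) :
    Letter.head q x ∉ R.map Letter.cell ++ none :: (L.map Letter.cell).reverse := by
  simp

theorem exists_represents {M : TM0.Machine Γ Λ} {b₀ : Γ} {c : TM0.Cfg Γ Λ} {L R : List Γ} {x : Γ}
    (hc : c.Tape = Tape.mk' (ListBlank.mk L) (ListBlank.mk (x :: R)))
    {d : State Γ Λ × List (Letter Γ Λ)} {y : Letter Γ Λ} {A B : List (Letter Γ Λ)}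
    (hd : StateTransition.Reaches₁ (step (rules M b₀)) d (some (y, none), A ++ .head c.q x :: B))
    (hA : ∀ q x, Letter.head q x ∉ A)
    (h : B ++ y :: A = R.map Letter.cell ++ none :: (L.map Letter.cell).reverse) :
    ∃ d', Represents c d' ∧ StateTransition.Reaches₁ (step (rules M b₀)) d d' := by
  obtain ⟨y', Q, h1, h2⟩ := reaches_rotation M b₀ (.head c.q x) A hA y B
  exact ⟨_, ⟨L, R, x, y', Q, hc, rfl, h2.trans h⟩, hd.trans_left h1⟩

/-- Here the head letter is the one held back; one more step puts it into the queue. -/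
theorem exists_represents_of_held {M : TM0.Machine Γ Λ} {b₀ : Γ} {c : TM0.Cfg Γ Λ} {L R : List Γ}
    {x : Γ} (hc : c.Tape = Tape.mk' (ListBlank.mk L) (ListBlank.mk (x :: R)))
    {d : State Γ Λ × List (Letter Γ Λ)} {A : List (Letter Γ Λ)}
    (hd : StateTransition.Reaches₁ (step (rules M b₀)) d (some (.head c.q x, none), A))
    (h : A = R.map Letter.cell ++ none :: (L.map Letter.cell).reverse) :
    ∃ d', Represents c d' ∧ StateTransition.Reaches₁ (step (rules M b₀)) d d' := by
  have hmem : ∀ q x, Letter.head q x ∉ A := fun q x => h ▸ head_notMem L R q x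
  obtain ⟨z, A, rfl⟩ := List.exists_cons_of_ne_nil (l := A) (by simp [h])
  refine exists_represents (A := A) (B := []) (y := z) hc (hd.tail ?_)
    (fun q x hm => hmem q x (List.mem_cons_of_mem _ hm)) h
  rcases z with _ | ⟨_ | q, x⟩
  · simp [step, rules, target, written]
  · simp [step, rules, target, written]
  · exact absurd List.mem_cons_self (hmem q x)

/-- A left move needs the letter before the head, which is the one held back; a right move is
completed when the next letter is read. A move that meets the separator inserts a blank square
there. -/
theorem respects (M : TM0.Machine Γ Λ) (b₀ : Γ) :
    StateTransition.Respects (TM0.step M) (step (rules M b₀)) Represents := by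
  rintro ⟨q, T⟩ d ⟨L, R, x, y, Q, hT, rfl, hQ⟩
  dsimp only at hT hQ ⊢
  have hfst : T.1 = x := by rw [hT]; rfl
  cases hM : M q x with
  | none => simp [TM0.step, hfst, hM, step, target, rules]
  | some r =>
    obtain ⟨q', a⟩ := r
    simp only [TM0.step, hfst, hM, Option.map_some]
    have hmem := fun q x => head_notMem (Λ := Λ) L R q x
    rw [← hQ] at hmem
    rcases a with (_ | _) | a
    · cases L with
      | nil =>
        obtain ⟨rfl, hy⟩ := List.append_inj' hQ rfl
        obtain rfl : y = none := by simpa using hy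
        refine exists_represents (L := []) (R := x :: R) (x := default) (y := .cell x)
          (A := R.map Letter.cell ++ [none]) (B := []) ?_ (.single ?_) hmem (by simp)
        · exact (congrArg _ hT).trans (Tape.move_left_mk' ..)
        · simp [step, target, written, rules, hM]
      | cons l L =>
        rw [List.map_cons, List.reverse_cons, ← List.cons_append, ← List.append_assoc] at hQ
        obtain ⟨rfl, hy⟩ := List.append_inj' hQ rfl
        obtain rfl : y = .cell l := by simpa using hy
        refine exists_represents (L := L) (R := x :: R) (x := l) (y := .cell x)
          (B := []) ?_ (.single ?_) (fun q x hm => hmem q x (List.mem_append_left _ hm)) (by simp)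
        · exact (congrArg _ hT).trans (Tape.move_left_mk' ..)
        · simp [step, target, written, rules, hM]
    · have h1 : (some (.cell x, some q'), Q ++ [y]) ∈
          step (rules M b₀) (some (y, none), .head q x :: Q) := by
        simp [step, target, written, rules, hM]
      rw [hQ] at h1
      cases R with
      | nil =>
        refine exists_represents (L := x :: L) (R := []) (x := default) (y := none)
          (A := (L.map Letter.cell).reverse ++ [.cell x]) (B := []) ?_
          (.tail (.single h1) ?_) (by simp) (by simp)
        · exact (congrArg _ hT).trans ((Tape.move_right_mk' ..).trans
            (congrArg _ (ListBlank.cons_head_tail _).symm))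
        · simp [step, target, written, rules]
      | cons l R =>
        refine exists_represents_of_held (L := x :: L) (R := R) (x := l)
          (A := R.map Letter.cell ++ none :: (L.map Letter.cell).reverse ++ [.cell x]) ?_
          (.tail (.single h1) ?_) (by simp)
        · exact (congrArg _ hT).trans (Tape.move_right_mk' ..)
        · simp [step, target, written, rules]
    · refine exists_represents_of_held (L := L) (R := R) (x := a) (A := Q ++ [y]) ?_
        (.single ?_) hQ
      · exact (congrArg _ hT).trans (Tape.write_mk' ..)
      · simp [step, target, written, rules, hM]

theorem eval_dom_iff (M : TM0.Machine Γ Λ) (b₀ b : Γ) (n : ℕ) :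
    (StateTransition.eval (step (rules M b₀)) (none, List.replicate (n + 1) (Letter.cell b))).Dom ↔
      (StateTransition.eval (TM0.step M) (TM0.init (b₀ :: List.replicate (n + 1) b))).Dom := by
  -- The initial rule appends the separator and the head letter with `b₀`, which completes the unary
  -- word to the initial tape.
  obtain ⟨d, hd, hr⟩ := exists_represents (M := M) (b₀ := b₀)
    (c := TM0.init (b₀ :: List.replicate (n + 1) b)) (L := []) (R := List.replicate (n + 1) b)
    (x := b₀) rfl (d := (none, List.replicate (n + 1) (Letter.cell b))) (y := Letter.cell b)
    (A := List.replicate n (Letter.cell b) ++ [none]) (B := [])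
    (.single (by simp [step, target, written, rules, List.replicate_succ, TM0.init]))
    (by simp) (by simp [List.replicate_succ])
  rw [StateTransition.reaches_eval hr.to_reflTransGen]
  exact StateTransition.tr_eval_dom (respects M b₀) hd

end TuringQueue

/-- A queue machine whose halting problem on unary inputs is the halting problem for partial
recursive functions. -/
theorem exists_queueMachine_dom :
    ∃ (S A : Type) (_ : Finite S) (_ : Finite A) (δ : QueueRules S A) (s : S) (a : A), ∀ n,
      (StateTransition.eval δ.step (s, List.replicate (n + 1) a)).Dom ↔
        ((Denumerable.ofNat Nat.Partrec.Code n).eval 0).Dom := by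
  obtain ⟨Γ, Λ, _, _, _, _, M, b₀, b, h⟩ := exists_turingMachine_dom
  exact ⟨_, _, inferInstance, inferInstance, TuringQueue.rules M b₀, none, .cell b,
    fun n => (TuringQueue.eval_dom_iff M b₀ b n).trans (h n)⟩

/-! ### Reversible two-head automata as Watson-Crick systems -/

/-- The renaming of the input symbols. -/
def TapeSymbol.map {σ τ : Type} (f : σ → τ) : TapeSymbol σ → TapeSymbol τ
  | .leftEnd => .leftEnd
  | .rightEnd => .rightEnd
  | .sym a => .sym (f a)

/-- The number of a tape symbol. -/
def TapeSymbol.toFin {s : ℕ} : TapeSymbol (Fin s) → Fin (s + 2)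
  | .leftEnd => 0
  | .rightEnd => 1
  | .sym a => a.succ.succ

/-- The tape symbol with a given number. -/
def TapeSymbol.ofFin {s : ℕ} (i : Fin (s + 2)) : TapeSymbol (Fin s) :=
  Fin.cases .leftEnd (Fin.cases .rightEnd .sym) i

@[simp]
theorem TapeSymbol.ofFin_toFin {s : ℕ} (x : TapeSymbol (Fin s)) : ofFin x.toFin = x := by
  cases x <;> rfl

/-- The rest of the tape that is seen by a head after a move. -/
def Move.shift {α : Type} : Move → List α → List α
  | .stay, l => l
  | .advance, l => l.tail

theorem WeightedRun.head {C : Type} {step : C → C → Prop} {cost : C → C → ℕ} {a b c : C} {k : ℕ}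
    (h : step a b) (hr : WeightedRun step cost b c k) :
    WeightedRun step cost a c (cost a b + k) := by
  induction hr with
  | refl => simpa using (WeightedRun.refl (step := step) (cost := cost) a).tail h
  | tail _ hs ih => simpa [add_assoc] using ih.tail hs

/-- A deterministic automaton with two heads that scan the tape in opposite directions; the head
movements are determined by the state that is entered. -/
structure TwoHead (σ Q : Type) where
  next : Q → TapeSymbol σ → TapeSymbol σ → Option Q
  move₁ : Q → Move
  move₂ : Q → Move
  start : Q
  accept : Q

namespace TwoHead

variable {σ Q : Type} (M : TwoHead σ Q)

/-- Backward determinism, and progress in every step; the accepting state is a dead end. -/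
structure Reversible : Prop where
  injective : ∀ {p q r x y}, M.next p x y = some r → M.next q x y = some r → p = q
  moves : ∀ q, M.move₁ q = .advance ∨ M.move₂ q = .advance
  next_accept : ∀ x y, M.next M.accept x y = none

/-- `M.Accepts q u v`: the accepting state is reached from the state `q`, where `u` and `v` are the
parts of the tape that are ahead of the two heads. -/
inductive Accepts : Q → List (TapeSymbol σ) → List (TapeSymbol σ) → Prop
  | here (x y : TapeSymbol σ) (u v : List (TapeSymbol σ)) : Accepts M.accept (x :: u) (y :: v)
  | step {q q' : Q} {x y : TapeSymbol σ} {u v : List (TapeSymbol σ)} (h : M.next q x y = some q')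
      (ha : Accepts q' ((M.move₁ q').shift (x :: u)) ((M.move₂ q').shift (y :: v))) :
      Accepts q (x :: u) (y :: v)

variable {M} in
theorem Accepts.ne_nil {q : Q} {u v : List (TapeSymbol σ)} (h : M.Accepts q u v) :
    u ≠ [] ∧ v ≠ [] := by
  cases h <;> simp

variable {s N : ℕ} (eσ : Fin s ≃ σ) (eQ : Q ≃ Fin N)

/-- The transition function on the numbers of the states and of the symbols. -/
def nextFin (q : Fin N) (x y : TapeSymbol (Fin s)) : Option (Fin N) :=
  (M.next (eQ.symm q) (x.map eσ) (y.map eσ)).map eQ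

/-- The rule of the upper component that sends every symbol that is read. -/
def upperRule (f : Fin N → TapeSymbol (Fin s) → TapeSymbol (Fin s) → Option (Fin N))
    (d : Fin N → Fin N → Move) : Rule (Fin s) (Fin (s + 2)) (Fin N) where
  broadcast _ x := some x.toFin
  trans q x a := a.bind fun a => (f q x (.ofFin a)).map fun q' => (q', d q q')

/-- The rule of the lower component that sends every symbol that is read. -/
def lowerRule (f : Fin N → TapeSymbol (Fin s) → TapeSymbol (Fin s) → Option (Fin N))
    (d : Fin N → Fin N → Move) : Rule (Fin s) (Fin (s + 2)) (Fin N) where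
  broadcast _ x := some x.toFin
  trans q y a := a.bind fun a => (f q (.ofFin a) y).map fun q' => (q', d q q')

theorem jointStep_iff {f g : Fin N → TapeSymbol (Fin s) → TapeSymbol (Fin s) → Option (Fin N)}
    {d e : Fin N → Fin N → Move} {p q p' q' : Fin N} {x y : TapeSymbol (Fin s)} {d₁ d₂ : Move} :
    JointStep (upperRule f d) (lowerRule g e) p x q y p' d₁ q' d₂ ↔
      (f p x y = some p' ∧ d p p' = d₁) ∧ g q x y = some q' ∧ e q q' = d₂ := by
  simp only [JointStep, upperRule, lowerRule, Option.bind_some, TapeSymbol.ofFin_toFin,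
    Option.map_eq_some_iff, Prod.mk.injEq]
  constructor
  · rintro ⟨⟨_, h1, rfl, h2⟩, _, h3, rfl, h4⟩
    exact ⟨⟨h1, h2⟩, h3, h4⟩
  · rintro ⟨⟨h1, h2⟩, h3, h4⟩
    exact ⟨⟨_, h1, rfl, h2⟩, _, h3, rfl, h4⟩

/-- A two-head automaton as a Watson-Crick system: both components keep track of the state. -/
def toDPWK : DPWK s where
  numMsg := s + 2
  numUpper := N
  numLower := N
  upper :=
    { upperRule (M.nextFin eσ eQ) (fun _ q => M.move₁ (eQ.symm q)) with
      start := eQ M.start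
      accept := {eQ M.accept} }
  lower :=
    { lowerRule (M.nextFin eσ eQ) (fun _ q => M.move₂ (eQ.symm q)) with
      start := eQ M.start
      accept := {eQ M.accept} }

theorem step_iff {w : List (Fin s)} {c c' : (M.toDPWK eσ eQ).Conf w} :
    (M.toDPWK eσ eQ).Step w c c' ↔
      M.nextFin eσ eQ c.state₁ (tapeAt w c.pos₁) (tapeAt w c.pos₂) = some c'.state₁ ∧
      M.nextFin eσ eQ c.state₂ (tapeAt w c.pos₁) (tapeAt w c.pos₂) = some c'.state₂ ∧
      c'.pos₁.val = c.pos₁.val + (M.move₁ (eQ.symm c'.state₁)).toNat ∧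
      c'.pos₂.val + (M.move₂ (eQ.symm c'.state₂)).toNat = c.pos₂.val := by
  refine (exists₂_congr fun d₁ d₂ => and_congr_left' jointStep_iff).trans ?_
  constructor
  · rintro ⟨_, _, ⟨⟨h1, rfl⟩, h2, rfl⟩, h3, h4⟩
    exact ⟨h1, h2, h3, h4⟩
  · rintro ⟨h1, h2, h3, h4⟩
    exact ⟨_, _, ⟨⟨h1, rfl⟩, h2, rfl⟩, h3, h4⟩

open Classical in
/-- The inverse of the transition function. -/
noncomputable def prevFin (q : Fin N) (x y : TapeSymbol (Fin s)) : Option (Fin N) :=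
  if h : ∃ p, M.nextFin eσ eQ p x y = some q then some h.choose else none

/-- The reverse rules. -/
noncomputable def reverseRules : (M.toDPWK eσ eQ).ReverseRules where
  upper := upperRule (M.prevFin eσ eQ) fun q _ => M.move₁ (eQ.symm q)
  lower := lowerRule (M.prevFin eσ eQ) fun q _ => M.move₂ (eQ.symm q)

variable {M}

theorem Reversible.nextFin_injective (hM : M.Reversible) {p q r : Fin N}
    {x y : TapeSymbol (Fin s)} (h1 : M.nextFin eσ eQ p x y = some r)
    (h2 : M.nextFin eσ eQ q x y = some r) : p = q := by
  simp only [nextFin, Option.map_eq_some_iff] at h1 h2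
  obtain ⟨a, h1, rfl⟩ := h1
  obtain ⟨b, h2, h⟩ := h2
  obtain rfl := eQ.injective h
  exact eQ.symm.injective (hM.injective h1 h2)

theorem Reversible.prevFin_eq_some_iff (hM : M.Reversible) {p q : Fin N}
    {x y : TapeSymbol (Fin s)} :
    M.prevFin eσ eQ q x y = some p ↔ M.nextFin eσ eQ p x y = some q := by
  unfold prevFin
  split_ifs with h
  · rw [Option.some_inj]
    exact ⟨fun e => e ▸ h.choose_spec, fun h' => hM.nextFin_injective eσ eQ h.choose_spec h'⟩
  · simp only [false_iff]
    exact fun h' => h ⟨p, h'⟩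

/-- The reverse moves are read off the current state, and the symbols then read are exactly those of
the forward step, so inverting the transition function suffices. -/
theorem Reversible.revStep_iff (hM : M.Reversible) {w : List (Fin s)}
    {c c' : (M.toDPWK eσ eQ).Conf w} :
    (M.toDPWK eσ eQ).RevStep (M.reverseRules eσ eQ) w c' c ↔ (M.toDPWK eσ eQ).Step w c c' := by
  rw [step_iff]
  refine (exists₂_congr fun d₁ d₂ => and_congr_left' jointStep_iff).trans ?_
  constructor
  · rintro ⟨_, _, ⟨⟨h1, rfl⟩, h2, rfl⟩, h3, h4⟩
    exact ⟨(hM.prevFin_eq_some_iff eσ eQ).1 h1, (hM.prevFin_eq_some_iff eσ eQ).1 h2, h3.symm,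
      h4.symm⟩
  · rintro ⟨h1, h2, h3, h4⟩
    exact ⟨_, _, ⟨⟨(hM.prevFin_eq_some_iff eσ eQ).2 h1, rfl⟩,
      (hM.prevFin_eq_some_iff eσ eQ).2 h2, rfl⟩, h3.symm, h4.symm⟩

/-- Two predecessors have equal positions, since the moves depend on the state entered. They read
the same symbols, and injectivity applies. -/
theorem Reversible.isReversedBy (hM : M.Reversible) :
    (M.toDPWK eσ eQ).IsReversedBy (M.reverseRules eσ eQ) := by
  refine ⟨fun w c₁ c₂ c' h1 h2 => ?_, fun w c c' => hM.revStep_iff eσ eQ⟩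
  rw [step_iff] at h1 h2
  obtain ⟨a1, b1, p1, q1⟩ := h1
  obtain ⟨a2, b2, p2, q2⟩ := h2
  have hp : c₁.pos₁ = c₂.pos₁ := Fin.ext (by omega)
  have hq : c₁.pos₂ = c₂.pos₂ := Fin.ext (by omega)
  rw [hp, hq] at a1 b1
  exact Config.ext (hM.nextFin_injective eσ eQ a1 a2) hp (hM.nextFin_injective eσ eQ b1 b2) hq

/-- Every step sends two messages and advances a head, so `k` is at most twice the total distance
travelled. -/
theorem Reversible.exists_weightedRun (hM : M.Reversible) {w : List (Fin s)}
    {c : (M.toDPWK eσ eQ).Conf w}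
    (hc : Relation.ReflTransGen ((M.toDPWK eσ eQ).Step w) ((M.toDPWK eσ eQ).init w) c) :
    ∃ k, c.state₁ = c.state₂ ∧ k + 2 * c.pos₂.val ≤ 2 * c.pos₁.val + 2 * (w.length + 1) ∧
      WeightedRun ((M.toDPWK eσ eQ).Step w) (fun b _ => (M.toDPWK eσ eQ).messages w b)
        ((M.toDPWK eσ eQ).init w) c k ∧
      WeightedRun ((M.toDPWK eσ eQ).RevStep (M.reverseRules eσ eQ) w)
        ((M.toDPWK eσ eQ).revMessages (M.reverseRules eσ eQ) w) c ((M.toDPWK eσ eQ).init w) k := by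
  induction hc with
  | refl => exact ⟨0, rfl, by simp [DPWK.init], .refl _, .refl _⟩
  | @tail b c _ hs ih =>
    obtain ⟨k, he, hk, h1, h2⟩ := ih
    refine ⟨k + 2, ?_, ?_, h1.tail hs, ?_⟩
    · rw [step_iff, he] at hs
      exact Option.some_inj.1 (hs.1.symm.trans hs.2.1)
    · rw [step_iff, he] at hs
      have hst := Option.some_inj.1 (hs.1.symm.trans hs.2.1)
      obtain ⟨-, -, h3, h4⟩ := hs
      rw [hst] at h3
      rcases hM.moves (eQ.symm c.state₂) with h | h
      · have h3 := h3.trans (congrArg (_ + Move.toNat ·) h)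
        simp only [Move.toNat] at h3
        omega
      · have h4 := (congrArg (_ + Move.toNat ·) h).symm.trans h4
        simp only [Move.toNat] at h4
        omega
    · rw [add_comm]
      exact h2.head ((hM.revStep_iff eσ eQ).2 hs)

theorem Reversible.isLinearREV (hM : M.Reversible) : (M.toDPWK eσ eQ).IsLinearREV := by
  -- At most 2(n + 1) steps with two messages each, and two more in the halting configuration.
  refine ⟨M.reverseRules eσ eQ, fun n => 4 * n + 6, hM.isReversedBy eσ eQ, ?_, ?_⟩
  · refine Asymptotics.IsBigO.of_bound 10 ?_
    filter_upwards [Filter.eventually_ge_atTop 1] with n hn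
    have : (1 : ℝ) ≤ n := by exact_mod_cast hn
    simp only [Real.norm_natCast]
    push_cast
    linarith
  · rintro w ⟨c, hr, hh, ha⟩
    obtain ⟨k, -, hk, h1, h2⟩ := hM.exists_weightedRun eσ eQ hr
    have h3 := c.pos₁.isLt
    refine ⟨c, k, k, hh, ha, h1, ?_, h2, ?_⟩
    · have : (M.toDPWK eσ eQ).messages w c = 2 := rfl
      change _ ≤ 4 * w.length + 6
      omega
    · change k ≤ 4 * w.length + 6
      omega

/-- The inscription of the tape. -/
def tape (w : List σ) : List (TapeSymbol σ) := .leftEnd :: (w.map .sym ++ [.rightEnd])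

theorem length_tape (w : List σ) : (tape w).length = w.length + 2 := by
  simp [tape]

theorem map_tapeAt (w : List (Fin s)) (i : Fin (w.length + 2)) :
    (tapeAt w i).map eσ = (tape (w.map eσ))[i.val]'(by simp [length_tape]) := by
  obtain ⟨i, hi⟩ := i
  unfold tapeAt tape
  cases i with
  | zero => rfl
  | succ i =>
    simp only [Nat.add_one_ne_zero, if_false, Nat.add_sub_cancel, List.getElem_cons_succ]
    split_ifs with h
    · rw [List.getElem_append_left (by simpa using h)]
      simp [TapeSymbol.map]
    · rw [List.getElem_append_right (by simpa using h)]
      simp [TapeSymbol.map]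

/-- The part of the tape from the position `i` on. -/
def ahead₁ (w : List σ) (i : ℕ) : List (TapeSymbol σ) := (tape w).drop i

/-- The part of the tape up to the position `i`, in the order in which the lower head scans it. -/
def ahead₂ (w : List σ) (i : ℕ) : List (TapeSymbol σ) := ((tape w).take (i + 1)).reverse

theorem ahead₁_eq (w : List (Fin s)) (i : Fin (w.length + 2)) :
    ahead₁ (w.map eσ) i = (tapeAt w i).map eσ :: ahead₁ (w.map eσ) (i + 1) := by
  rw [map_tapeAt, ahead₁, ahead₁, List.drop_eq_getElem_cons]

theorem ahead₂_eq (w : List (Fin s)) (i : Fin (w.length + 2)) :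
    ahead₂ (w.map eσ) i = (tapeAt w i).map eσ :: ((tape (w.map eσ)).take i).reverse := by
  rw [map_tapeAt, ahead₂, List.take_succ_eq_append_getElem (by simp [length_tape]),
    List.reverse_append]
  rfl

theorem accepts_of_reaches {w : List (Fin s)} {c c' : (M.toDPWK eσ eQ).Conf w}
    (hr : Relation.ReflTransGen ((M.toDPWK eσ eQ).Step w) c c')
    (hs : c.state₁ = c.state₂) (hc' : c'.state₁ = eQ M.accept ∨ c'.state₂ = eQ M.accept) :
    M.Accepts (eQ.symm c.state₁) (ahead₁ (w.map eσ) c.pos₁) (ahead₂ (w.map eσ) c.pos₂) := by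
  induction hr using Relation.ReflTransGen.head_induction_on with
  | refl =>
    have : c'.state₁ = eQ M.accept := hc'.elim id fun h => hs.trans h
    rw [this, Equiv.symm_apply_apply, ahead₁_eq, ahead₂_eq]
    exact .here ..
  | @head c d hstep _ ih =>
    rw [step_iff, ← hs] at hstep
    have hst := Option.some_inj.1 (hstep.1.symm.trans hstep.2.1)
    obtain ⟨h1, -, h3, h4⟩ := hstep
    specialize ih hst
    obtain ⟨q, h1, hq⟩ := Option.map_eq_some_iff.1 h1
    rw [← hst] at h4
    rw [← hq, Equiv.symm_apply_apply] at ih h3 h4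
    rw [ahead₁_eq, ahead₂_eq]
    refine .step h1 ?_
    rw [← ahead₁_eq, ← ahead₂_eq]
    convert ih using 1
    · rw [h3]
      cases M.move₁ q <;> simp [Move.shift, Move.toNat, ahead₁]
    · cases hm : M.move₂ q with
      | stay =>
        rw [hm] at h4
        rw [← h4]
        rfl
      | advance =>
        rw [hm] at h4
        rw [ahead₂_eq, ← h4]
        rfl

/-- Acceptance requires nonempty lists ahead of both heads at every stage, which is what keeps the
heads on the tape. -/
theorem Accepts.exists_reaches {q : Q} {u v : List (TapeSymbol σ)} (h : M.Accepts q u v)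
    {w : List (Fin s)} {i j : Fin (w.length + 2)} (hu : u = ahead₁ (w.map eσ) i)
    (hv : v = ahead₂ (w.map eσ) j) :
    ∃ c' : (M.toDPWK eσ eQ).Conf w, c'.state₁ = eQ M.accept ∧ c'.state₂ = eQ M.accept ∧
      Relation.ReflTransGen ((M.toDPWK eσ eQ).Step w) ⟨eQ q, i, eQ q, j⟩ c' := by
  induction h generalizing i j with
  | here => exact ⟨_, rfl, rfl, .refl⟩
  | @step q q' x y u v h ha ih =>
    have hne : (M.move₁ q').shift (x :: u) ≠ [] ∧ (M.move₂ q').shift (y :: v) ≠ [] :=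
      ha.ne_nil
    rw [ahead₁_eq] at hu
    rw [ahead₂_eq] at hv
    obtain ⟨hx, hu⟩ := List.cons.inj hu
    obtain ⟨hy, hv⟩ := List.cons.inj hv
    have hi : ∃ i' : Fin (w.length + 2), i'.val = i.val + (M.move₁ q').toNat ∧
        (M.move₁ q').shift (x :: u) = ahead₁ (w.map eσ) i' := by
      cases hm : M.move₁ q' with
      | stay => exact ⟨i, rfl, by rw [ahead₁_eq, Move.shift, hx, hu]⟩
      | advance =>
        rw [hm] at hne
        have : i.val + 1 < w.length + 2 := by
          by_contra hc
          refine hne.1 ?_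
          simp only [Move.shift, List.tail_cons, hu, ahead₁]
          exact List.drop_eq_nil_of_le (by simp [length_tape]; omega)
        exact ⟨⟨i + 1, this⟩, rfl, hu⟩
    have hj : ∃ j' : Fin (w.length + 2), j'.val + (M.move₂ q').toNat = j.val ∧
        (M.move₂ q').shift (y :: v) = ahead₂ (w.map eσ) j' := by
      cases hm : M.move₂ q' with
      | stay => exact ⟨j, rfl, by rw [ahead₂_eq, Move.shift, hy, hv]⟩
      | advance =>
        rw [hm] at hne
        obtain ⟨j, hj⟩ := j
        cases j with
        | zero => exact absurd (by simp [Move.shift, hv]) hne.2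
        | succ j => exact ⟨⟨j, by omega⟩, rfl, hv⟩
    obtain ⟨i', hi, hi'⟩ := hi
    obtain ⟨j', hj, hj'⟩ := hj
    obtain ⟨c', h1, h2, h3⟩ := ih hi' hj'
    have hn : M.nextFin eσ eQ (eQ q) (tapeAt w i) (tapeAt w j) = some (eQ q') := by
      rw [nextFin, Equiv.symm_apply_apply, ← hx, ← hy, h, Option.map_some]
    refine ⟨c', h1, h2, .head ((M.step_iff eσ eQ).2 ⟨hn, hn, ?_, ?_⟩) h3⟩
    · rw [Equiv.symm_apply_apply]
      exact hi
    · rw [Equiv.symm_apply_apply]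
      exact hj

theorem Reversible.mem_language_iff (hM : M.Reversible) (w : List (Fin s)) :
    w ∈ (M.toDPWK eσ eQ).language ↔
      M.Accepts M.start (tape (w.map eσ)) (tape (w.map eσ)).reverse := by
  have h1 : ahead₁ (w.map eσ) (0 : Fin (w.length + 2)).val = tape (w.map eσ) := rfl
  have h2 : ahead₂ (w.map eσ) (Fin.last (w.length + 1)).val = (tape (w.map eσ)).reverse := by
    rw [ahead₂, List.take_of_length_le (by simp [length_tape])]
  constructor
  · rintro ⟨c, hr, -, ha⟩
    have := accepts_of_reaches eσ eQ hr rfl (ha.imp Finset.mem_singleton.1 Finset.mem_singleton.1)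
    change M.Accepts (eQ.symm (eQ M.start)) (ahead₁ (w.map eσ) (0 : Fin (w.length + 2)).val)
      (ahead₂ (w.map eσ) (Fin.last (w.length + 1)).val) at this
    rwa [Equiv.symm_apply_apply, h1, h2] at this
  · intro h
    obtain ⟨c, hc1, hc2, hr⟩ := h.exists_reaches eσ eQ h1.symm h2.symm
    refine ⟨c, hr, fun c' hs => ?_, .inl (Finset.mem_singleton.2 hc1)⟩
    have := (M.step_iff eσ eQ).1 hs |>.1
    rw [hc1, nextFin, Equiv.symm_apply_apply, hM.next_accept] at this
    simp at this

end TwoHead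

/-! ### The history automaton and its reversibility -/

namespace QueueHistory

open TwoHead

/-- The input symbols: a letter that is removed from the queue, together with the state in which
this happens (`none` after the end of the computation) and a mark; a separator; padding. -/
inductive Sym (S A : Type) where
  | cell (o : Option S) (a : A) (marked : Bool)
  | mid
  | junk

/-- The states of the history automaton that do not depend on the input of the queue machine. -/
inductive Ctl (S : Type) where
  | acc
  | pad
  | fst
  | snd
  | skip
  | sim (o : Option S)

instance {S A : Type} [Finite S] [Finite A] : Finite (Sym S A) := by
  refine Finite.of_surjective (α := (Option S × A × Bool) ⊕ Bool)
    (fun | .inl (o, a, b) => .cell o a b | .inr true => .mid | .inr false => .junk) fun x => ?_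
  cases x with
  | cell o a b => exact ⟨.inl (o, a, b), rfl⟩
  | mid => exact ⟨.inr true, rfl⟩
  | junk => exact ⟨.inr false, rfl⟩

instance {S : Type} [Finite S] : Finite (Ctl S) := by
  refine Finite.of_surjective (α := Option S ⊕ Fin 5)
    (fun | .inl o => .sim o | .inr 0 => .acc | .inr 1 => .pad | .inr 2 => .fst | .inr 3 => .snd
         | .inr 4 => .skip) fun x => ?_
  cases x with
  | sim o => exact ⟨.inl o, rfl⟩
  | acc => exact ⟨.inr 0, rfl⟩
  | pad => exact ⟨.inr 1, rfl⟩
  | fst => exact ⟨.inr 2, rfl⟩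
  | snd => exact ⟨.inr 3, rfl⟩
  | skip => exact ⟨.inr 4, rfl⟩

open Classical

variable {S A : Type} (δ : QueueRules S A) (s₀ : S) (a₀ : A)

/-- The comparison of the letter `a` with the first letter written by the rule `r`. -/
noncomputable def compareFst (a : A) (r : S × A) : Option (Ctl S) :=
  if (δ r.1 r.2).1 = a then some (if (δ r.1 r.2).2.1 = none then .fst else .snd) else none

/-- The transitions between the states that do not depend on the input of the queue machine. -/
noncomputable def ctlNext :
    Ctl S → TapeSymbol (Sym S A) → TapeSymbol (Sym S A) → Option (Ctl S)
  | .pad, .sym (.cell _ _ true), .sym .junk => some .pad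
  | .pad, .sym (.cell _ a true), .sym (.cell (some s) b _) => compareFst δ a (s, b)
  | .fst, .sym (.cell _ a false), .sym (.cell (some s) b _) => compareFst δ a (s, b)
  | .snd, .sym (.cell _ a false), .sym (.cell (some s) b _) =>
    if (δ s b).2.1 = some a then some .fst else none
  | .fst, .sym .mid, .sym .mid => some .skip
  | .skip, .sym .mid, .sym (.cell none _ _) => some .skip
  | .skip, .sym .mid, .sym (.cell (some _) _ _) => some (.sim none)
  | .sim o, .sym (.cell (some s) a _), .sym (.cell (some s') b _) =>
    if s = s' ∧ a = b ∧ δ.target (s, a) = o then some (.sim (some s)) else none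
  | .sim o, .sym .junk, .leftEnd => if o = some s₀ then some .acc else none
  | _, _, _ => none

/-- The symbols that are scanned by the upper head in the states of the chain. -/
def chainSymbol : TapeSymbol (Sym S A) → TapeSymbol (Sym S A) → Prop
  | .leftEnd, .rightEnd => True
  | .sym (.cell _ a false), .rightEnd => a = a₀
  | _, _ => False

/-- The symbols on which the chain is left. -/
def chainExit : TapeSymbol (Sym S A) → TapeSymbol (Sym S A) → Prop
  | .sym (.cell _ _ true), .rightEnd => True
  | _, _ => False

/-- The states of the history automaton: the summand `Fin (n + 3)` is a chain of states that checks
that the first `n + 1` letters are those of the input of the queue machine. -/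
abbrev State (S : Type) (n : ℕ) : Type := Ctl S ⊕ Fin (n + 3)

/-- The transitions of the history automaton. -/
noncomputable def next (n : ℕ) :
    State S n → TapeSymbol (Sym S A) → TapeSymbol (Sym S A) → Option (State S n)
  | .inl q, x, y => (ctlNext δ s₀ q x y).map .inl
  | .inr ⟨0, _⟩, x, y => if chainExit x y then some (.inl .pad) else none
  | .inr ⟨i + 1, h⟩, x, y =>
    if chainSymbol a₀ x y then some (.inr ⟨i, Nat.lt_of_succ_lt h⟩) else none

/-- Whether the upper head moves on entering a state. -/
def upperMove {n : ℕ} : State S n → Move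
  | .inl .pad | .inl .skip => .stay
  | _ => .advance

/-- Whether the lower head moves on entering a state. -/
def lowerMove {n : ℕ} : State S n → Move
  | .inl .pad | .inl .skip | .inl .fst | .inl (.sim (some _)) => .advance
  | _ => .stay

/-- The automaton that accepts the histories of the halting computation of a queue machine on the
input `a₀ ^ (n + 1)`. -/
noncomputable def automaton (n : ℕ) : TwoHead (Sym S A) (State S n) where
  next := next δ s₀ a₀ n
  move₁ := upperMove
  move₂ := lowerMove
  start := .inr (Fin.last (n + 2))
  accept := .inl .acc

/-- The mark tells a step out of `pad` from one out of `fst`. Whether the rule read has a second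
letter tells the ways into `fst` apart, and the lower symbol does so for `skip`. In the backward
check the previous state must be the target of the rule read. -/
theorem ctlNext_injective {p q r : Ctl S} {x y : TapeSymbol (Sym S A)}
    (h1 : ctlNext δ s₀ p x y = some r) (h2 : ctlNext δ s₀ q x y = some r) : p = q := by
  unfold ctlNext compareFst at h1
  split at h1 <;> unfold ctlNext compareFst at h2 <;> grind

/-- Only the exit from the chain reads a marked letter against the right endmarker, so it cannot be
confused with the loop at `pad`. -/
theorem ctlNext_chain {q r : Ctl S} {x y : TapeSymbol (Sym S A)}
    (h : ctlNext δ s₀ q x y = some r) : ¬ chainExit x y := by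
  unfold ctlNext at h
  split at h <;> simp_all [chainExit]

theorem reversible (n : ℕ) : (automaton δ s₀ a₀ n).Reversible where
  injective {p q r x y} h1 h2 := by
    simp only [automaton] at h1 h2
    rcases p with p | ⟨_ | i, hi⟩ <;> rcases q with q | ⟨_ | j, hj⟩ <;>
      simp only [next, Option.map_eq_some_iff, Option.ite_none_right_eq_some, Option.some_inj]
        at h1 h2
    · obtain ⟨a, h1, rfl⟩ := h1
      obtain ⟨b, h2, h⟩ := h2
      rw [Sum.inl_injective h] at h2
      rw [ctlNext_injective δ s₀ h1 h2]
    · obtain ⟨a, h1, rfl⟩ := h1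
      exact absurd h2.1 (ctlNext_chain δ s₀ h1)
    · grind
    · obtain ⟨a, h2, rfl⟩ := h2
      exact absurd h1.1 (ctlNext_chain δ s₀ h2)
    · rfl
    · grind
    · grind
    · grind
    · grind
  moves q := by
    rcases q with (_ | _ | _ | _ | _ | _) | _ <;> simp [automaton, upperMove, lowerMove]
  next_accept x y := by
    simp [automaton, next, ctlNext]

end QueueHistory

/-! ### What an accepting run says about the tape -/

namespace QueueHistory

open TwoHead
open Classical

variable {S A : Type} (δ : QueueRules S A) (s₀ : S) (a₀ : A)

/-- The letter and the state that are recorded in a tape symbol. -/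
def item : TapeSymbol (Sym S A) → Option (Option S × A)
  | .sym (.cell o a _) => some (o, a)
  | _ => none

/-- The tape symbols record the given letters and states. -/
def Records (c : List (TapeSymbol (Sym S A))) (l : List (Option S × A)) : Prop :=
  c.map item = l.map some

/-- The letters and states of a list of rules. -/
def ruleItems (l : List (S × A)) : List (Option S × A) := l.map fun r => (some r.1, r.2)

theorem item_eq_some {x : TapeSymbol (Sym S A)} {i : Option S × A} :
    item x = some i ↔ ∃ b, x = .sym (.cell i.1 i.2 b) := by
  unfold item
  split
  · obtain ⟨o, a⟩ := i
    simp
  · rename_i h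
    simp only [reduceCtorEq, false_iff, not_exists]
    exact fun b e => h _ _ _ e

theorem records_cons {c : List (TapeSymbol (Sym S A))} {i : Option S × A}
    {l : List (Option S × A)} :
    Records c (i :: l) ↔ ∃ b c', c = .sym (.cell i.1 i.2 b) :: c' ∧ Records c' l := by
  cases c with
  | nil => simp [Records]
  | cons x c =>
    simp only [Records, List.map_cons, List.cons.injEq, item_eq_some]
    constructor
    · rintro ⟨⟨b, rfl⟩, h⟩
      exact ⟨b, c, ⟨rfl, rfl⟩, h⟩
    · rintro ⟨b, _, ⟨rfl, rfl⟩, h⟩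
      exact ⟨⟨b, rfl⟩, h⟩

theorem records_nil {c : List (TapeSymbol (Sym S A))} : Records c [] ↔ c = [] := by
  simp [Records]

theorem Records.append {c d : List (TapeSymbol (Sym S A))} {l m : List (Option S × A)}
    (h1 : Records c l) (h2 : Records d m) : Records (c ++ d) (l ++ m) := by
  simp only [Records, List.map_append] at *
  rw [h1, h2]

theorem Records.reverse {c : List (TapeSymbol (Sym S A))} {l : List (Option S × A)}
    (h : Records c l) : Records c.reverse l.reverse := by
  simp only [Records, List.map_reverse] at *
  rw [h]

/-- The parts of the tape that are ahead of the heads in an accepting computation from a state in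
which the computation of the queue machine is checked backwards. -/
def SimSpec (o : Option S) (u v : List (TapeSymbol (Sym S A))) : Prop :=
  ∃ c d l u' v', u = c ++ .sym .junk :: u' ∧ v = d ++ .leftEnd :: v' ∧
    Records c (ruleItems l) ∧ Records d (ruleItems l) ∧ δ.Path (some s₀) l.reverse o

/-- The tape ahead of the heads while the letters after the end of the computation are skipped. -/
def SkipSpec (u v : List (TapeSymbol (Sym S A))) : Prop :=
  ∃ (u' d : List (TapeSymbol (Sym S A))) (e : List A) (v' : List (TapeSymbol (Sym S A))),
    u = .sym .mid :: u' ∧ v = d ++ v' ∧ Records d (e.map fun a => (none, a)) ∧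
    SimSpec δ s₀ none u' v'

/-- The tape ahead of the heads while the letters that are removed from the queue, and are ahead of
the upper head, are compared with `p` and the letters that are written by the rules ahead of the
lower head. -/
def CompareSpec (p : List A) (u v : List (TapeSymbol (Sym S A))) : Prop :=
  ∃ c d i l u' v', u = c ++ .sym .mid :: u' ∧ v = d ++ .sym .mid :: v' ∧
    Records c i ∧ Records d (ruleItems l) ∧ i.map Prod.snd = p ++ l.flatMap δ.written ∧
    SkipSpec δ s₀ (.sym .mid :: u') v'

/-- The tape ahead of the heads while the padding is skipped. -/
def PadSpec (u v : List (TapeSymbol (Sym S A))) : Prop :=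
  ∃ j v', v = List.replicate j (.sym .junk) ++ v' ∧ CompareSpec δ s₀ [] u v'

/-- The tape ahead of the heads in an accepting computation. -/
def Spec {n : ℕ} : State S n → List (TapeSymbol (Sym S A)) → List (TapeSymbol (Sym S A)) → Prop
  | .inl .acc, _, _ => True
  | .inl .pad, u, v => PadSpec δ s₀ u v
  | .inl .fst, u, v => CompareSpec δ s₀ [] u v
  | .inl .snd, u, v => ∃ (x : TapeSymbol (Sym S A)) (r : S × A)
      (v' : List (TapeSymbol (Sym S A))), v = x :: v' ∧ item x = some (some r.1, r.2) ∧
      CompareSpec δ s₀ (δ r.1 r.2).2.1.toList u v'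
  | .inl .skip, u, v => SkipSpec δ s₀ u v
  | .inl (.sim o), u, v => SimSpec δ s₀ o u v
  | .inr i, u, v => ∃ pre u' v', u = pre ++ u' ∧ v = .rightEnd :: v' ∧ pre.length = i ∧
      (∀ x ∈ pre, chainSymbol a₀ x .rightEnd) ∧ PadSpec δ s₀ u' v'

variable {δ s₀ a₀}

theorem CompareSpec.cons {p : List A} {u v : List (TapeSymbol (Sym S A))} {o : Option S} {a : A}
    {b : Bool} (h : CompareSpec δ s₀ p u v) :
    CompareSpec δ s₀ (a :: p) (.sym (.cell o a b) :: u) v := by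
  obtain ⟨c, d, i, l, u', v', rfl, rfl, h1, h2, h3, h4⟩ := h
  exact ⟨.sym (.cell o a b) :: c, d, (o, a) :: i, l, u', v', rfl, rfl,
    records_cons.2 ⟨b, c, rfl, h1⟩, h2, by simp [h3], h4⟩

theorem CompareSpec.written {p : List A} {u v : List (TapeSymbol (Sym S A))} {r : S × A}
    {b : Bool} (hp : p = δ.written r) (h : CompareSpec δ s₀ p u v) :
    CompareSpec δ s₀ [] u (.sym (.cell (some r.1) r.2 b) :: v) := by
  obtain ⟨c, d, i, l, u', v', rfl, rfl, h1, h2, h3, h4⟩ := h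
  exact ⟨c, .sym (.cell (some r.1) r.2 b) :: d, i, r :: l, u', v', rfl, rfl, h1,
    records_cons.2 ⟨b, d, rfl, h2⟩, by simp [h3, hp], h4⟩

/-- Shared by `pad` and `fst`. For a rule with one letter the lower head has moved on; for two
letters it still stands on the rule, and the specification of `snd` supplies the second letter. -/
theorem compareSpec_of_compareFst {n : ℕ} {a : A} {o : Option S} {s : S} {b : A} {m m' : Bool}
    {q : Ctl S} (h : compareFst δ a (s, b) = some q) {u v : List (TapeSymbol (Sym S A))}
    (hs : Spec δ s₀ a₀ (n := n) (.inl q) u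
      ((lowerMove (n := n) (.inl q)).shift (.sym (.cell (some s) b m') :: v))) :
    CompareSpec δ s₀ [] (.sym (.cell o a m) :: u) (.sym (.cell (some s) b m') :: v) := by
  simp only [compareFst, Option.ite_none_right_eq_some, Option.some_inj] at h
  obtain ⟨rfl, rfl⟩ := h
  split_ifs at hs with h
  · exact CompareSpec.written (r := (s, b)) (p := [(δ s b).1])
      (by simp [QueueRules.written, h]) (CompareSpec.cons (p := []) hs)
  · obtain ⟨x, r, v', hx, hi, hs⟩ := hs
    simp only [lowerMove, Move.shift, List.cons.injEq] at hx
    obtain ⟨rfl, rfl⟩ := hx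
    obtain ⟨rfl, rfl⟩ : s = r.1 ∧ b = r.2 := by simpa [item] using hi
    exact CompareSpec.written (r := r) rfl (CompareSpec.cons hs)

/-- The induction runs backwards from acceptance, so the specifications concern only the tape still
ahead and need no invariant about the part already scanned. -/
theorem spec_of_step {n : ℕ} {q q' : State S n} {x y : TapeSymbol (Sym S A)}
    {u v : List (TapeSymbol (Sym S A))} (h : next δ s₀ a₀ n q x y = some q')
    (hs : Spec δ s₀ a₀ q' ((upperMove q').shift (x :: u)) ((lowerMove q').shift (y :: v))) :
    Spec δ s₀ a₀ q (x :: u) (y :: v) := by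
  rcases q with q | ⟨_ | i, hi⟩
  · obtain ⟨q', h', rfl⟩ := Option.map_eq_some_iff.1 h
    clear h
    rename' h' => h
    unfold ctlNext at h
    split at h
    · obtain rfl : Ctl.pad = q' := by simpa using h
      obtain ⟨j, v', hv, hs⟩ := hs
      exact ⟨j + 1, v', by simpa [List.replicate_succ, lowerMove, Move.shift] using hv, hs⟩
    · refine ⟨0, _, rfl, ?_⟩
      refine compareSpec_of_compareFst (n := n) (a₀ := a₀) h ?_
      have : upperMove (n := n) (.inl q') = .advance := by
        simp only [compareFst, Option.ite_none_right_eq_some, Option.some_inj] at h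
        obtain ⟨-, rfl⟩ := h
        split_ifs <;> rfl
      rwa [this] at hs
    · refine compareSpec_of_compareFst (n := n) (a₀ := a₀) h ?_
      have : upperMove (n := n) (.inl q') = .advance := by
        simp only [compareFst, Option.ite_none_right_eq_some, Option.some_inj] at h
        obtain ⟨-, rfl⟩ := h
        split_ifs <;> rfl
      rwa [this] at hs
    · simp only [Option.ite_none_right_eq_some, Option.some_inj] at h
      obtain ⟨h, rfl⟩ := h
      rename_i s b m'
      refine ⟨_, (s, b), v, rfl, rfl, ?_⟩
      rw [h]
      exact CompareSpec.cons hs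
    · obtain rfl : Ctl.skip = q' := by simpa using h
      have hs' := hs
      obtain ⟨u', d, e, v', hu, hv, h1, h2⟩ := hs'
      exact ⟨[], [], [], [], u, v, rfl, rfl, rfl, rfl, rfl, hs⟩
    · obtain rfl : Ctl.skip = q' := by simpa using h
      obtain ⟨u', d, e, v', hu, hv, h1, h2⟩ := hs
      rename_i a m
      refine ⟨u', .sym (.cell none a m) :: d, a :: e, v', hu, ?_, records_cons.2 ⟨m, d, rfl, h1⟩,
        h2⟩
      change v = _ at hv
      rw [hv]
      rfl
    · obtain rfl : Ctl.sim none = q' := by simpa using h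
      exact ⟨u, [], [], _, rfl, rfl, rfl, hs⟩
    · simp only [Option.ite_none_right_eq_some, Option.some_inj] at h
      obtain ⟨⟨rfl, rfl, ho⟩, rfl⟩ := h
      rename_i o s a m m'
      obtain ⟨c, d, l, u', v', hu, hv, h1, h2, h3⟩ := hs
      change u = _ at hu
      change v = _ at hv
      refine ⟨.sym (.cell (some s) a m) :: c, .sym (.cell (some s) a m') :: d, (s, a) :: l, u', v',
        by rw [hu]; rfl, by rw [hv]; rfl, records_cons.2 ⟨m, c, rfl, h1⟩,
        records_cons.2 ⟨m', d, rfl, h2⟩, ?_⟩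
      rw [List.reverse_cons, QueueRules.path_append_singleton]
      exact ⟨h3, ho⟩
    · simp only [Option.ite_none_right_eq_some, Option.some_inj] at h
      obtain ⟨rfl, rfl⟩ := h
      exact ⟨[], [], [], u, v, rfl, rfl, rfl, rfl, rfl⟩
    · simp at h
  · simp only [next, Option.ite_none_right_eq_some, Option.some_inj] at h
    obtain ⟨h, rfl⟩ := h
    unfold chainExit at h
    split at h
    · exact ⟨[], _, v, rfl, rfl, rfl, by simp, hs⟩
    · exact h.elim
  · simp only [next, Option.ite_none_right_eq_some, Option.some_inj] at h
    obtain ⟨h, rfl⟩ := h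
    obtain ⟨pre, u', v', hu, hv, h1, h2, h3⟩ := hs
    change u = _ at hu
    change y :: v = _ at hv
    obtain ⟨rfl, rfl⟩ := List.cons.inj hv
    refine ⟨x :: pre, u', v, by rw [hu]; rfl, rfl, by simp [h1], ?_, h3⟩
    simp only [List.mem_cons, forall_eq_or_imp]
    exact ⟨h, h2⟩

theorem spec_of_accepts {n : ℕ} {q : State S n} {u v : List (TapeSymbol (Sym S A))}
    (h : (automaton δ s₀ a₀ n).Accepts q u v) : Spec δ s₀ a₀ q u v := by
  induction h with
  | here => exact trivial
  | step h _ ih => exact spec_of_step h ih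

end QueueHistory

/-! ### Accepted words and halting computations -/

namespace QueueHistory

open TwoHead

variable {S A : Type} {δ : QueueRules S A} {s₀ : S} {a₀ : A} {n : ℕ}

theorem append_cons_inj_of_notMem {α : Type} {x : α} {a b c d : List α} (ha : x ∉ a) (hc : x ∉ c)
    (h : a ++ x :: b = c ++ x :: d) : a = c ∧ b = d := by
  induction a generalizing c with
  | nil =>
    cases c with
    | nil => exact ⟨rfl, (List.cons.inj h).2⟩
    | cons y c => exact absurd (List.mem_cons.2 (.inl (List.cons.inj h).1)) hc
  | cons y a ih =>
    cases c with
    | nil => exact absurd (List.mem_cons.2 (.inl (List.cons.inj h).1.symm)) ha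
    | cons z c =>
      obtain ⟨rfl, h'⟩ := List.cons.inj h
      obtain ⟨rfl, h''⟩ := ih (fun hm => ha (.tail _ hm)) (fun hm => hc (.tail _ hm)) h'
      exact ⟨rfl, h''⟩

theorem Records.item_ne_none {c : List (TapeSymbol (Sym S A))} {l : List (Option S × A)}
    (h : Records c l) {x : TapeSymbol (Sym S A)} (hx : x ∈ c) : item x ≠ none := by
  intro hn
  have : item x ∈ c.map item := List.mem_map_of_mem hx
  rw [h, hn] at this
  simp at this

theorem exists_records_of_chainSymbol (c : List (TapeSymbol (Sym S A)))
    (h : ∀ x ∈ c, chainSymbol a₀ x .rightEnd ∧ x ≠ .leftEnd) :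
    ∃ i, Records c i ∧ i.map Prod.snd = List.replicate c.length a₀ := by
  induction c with
  | nil => exact ⟨[], rfl, rfl⟩
  | cons x c ih =>
    obtain ⟨i, h1, h2⟩ := ih fun y hy => h y (.tail _ hy)
    obtain ⟨hx, hl⟩ := h x List.mem_cons_self
    unfold chainSymbol at hx
    split at hx
    · exact absurd rfl hl
    · rename_i o a _
      exact ⟨(o, a) :: i, records_cons.2 ⟨false, c, rfl, h1⟩, by
        rw [List.map_cons, h2, hx]
        rfl⟩
    · exact hx.elim

theorem ruleItems_injective : Function.Injective (ruleItems : List (S × A) → _) :=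
  List.map_injective_iff.2 fun r r' h => by
    simp only [Prod.mk.injEq, Option.some_inj] at h
    exact Prod.ext h.1 h.2

/-- The views of the two heads describe one word. Cutting both at the symbols that record no letter
identifies the second block as the reversal of the rules in the first, and the first as input
followed by written letters. -/
theorem eval_dom_of_spec (w : List (Sym S A))
    (h : Spec δ s₀ a₀ (n := n) (.inr (Fin.last (n + 2))) (tape w) (tape w).reverse) :
    (StateTransition.eval δ.step (s₀, List.replicate (n + 1) a₀)).Dom := by
  obtain ⟨pre, u₁, v₁, hu, hv, hlen, hpre, j, v₂, rfl, c, d, i, l, u₂, v₃, rfl, rfl, hc, hd, hil,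
    u₃, d₂, e, v₄, hu₃, rfl, hd₂, c₂, d₃, l', u₄, v₅, rfl, rfl, hc₂, hd₃, hp⟩ := h
  obtain ⟨-, rfl⟩ := List.cons.inj hu₃
  cases pre with
  | nil => simp at hlen
  | cons x pre =>
  obtain ⟨rfl, hu'⟩ := List.cons.inj hu
  change _ = pre ++ (c ++ _) at hu'
  -- The chain also accepts the left endmarker, but this occurs only in front; the other n + 1 chain
  -- symbols are therefore letters.
  have hleft : TapeSymbol.leftEnd ∉ w.map TapeSymbol.sym ++ [.rightEnd] := by simp
  obtain ⟨i₀, hi₀, hi₀'⟩ := exists_records_of_chainSymbol (a₀ := a₀) pre fun x hx =>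
    ⟨hpre x (.tail _ hx), fun e => hleft (by rw [hu', ← e]; exact List.mem_append_left _ hx)⟩
  have hlen : pre.length = n + 1 := by simpa using hlen
  rw [hlen] at hi₀'
  have hd2d := hd₂.append hd₃
  have hv : (w.map TapeSymbol.sym ++ [TapeSymbol.rightEnd]).reverse =
      TapeSymbol.rightEnd :: (List.replicate j (.sym .junk) ++ (d ++ .sym .mid :: (d₂ ++ d₃))) ∧ [] = v₅ := by
    refine append_cons_inj_of_notMem (by simp) ?_ ?_ (x := TapeSymbol.leftEnd)
    · simp only [List.mem_cons, List.mem_append, List.mem_replicate, not_or, reduceCtorEq,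
        and_false, not_false_eq_true, true_and]
      exact ⟨fun h => hd.item_ne_none h rfl, fun h => hd₂.item_ne_none h rfl,
        fun h => hd₃.item_ne_none h rfl⟩
    · rw [← List.reverse_cons]
      exact hv.trans (by simp)
  -- `item` forgets the marks and maps separator, padding and endmarkers to `none`. The right
  -- endmarker thus guarantees a `none` after the second block even when `j` is 0.
  have hT := congrArg (fun t => (List.reverse t).map item) hv.1
  have hone : item (.sym .mid : TapeSymbol (Sym S A)) = none := rfl
  have htwo : item (.sym .junk : TapeSymbol (Sym S A)) = none := rfl
  have hthree : item (.rightEnd : TapeSymbol (Sym S A)) = none := rfl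
  simp only [List.reverse_reverse, hu'] at hT
  have hL := (hi₀.append hc)
  have hR := hd2d.reverse
  have hdr := hd.reverse
  unfold Records at hL hR hdr hc₂
  simp only [List.reverse_cons, List.reverse_append, List.append_assoc, List.cons_append,
    List.nil_append, List.map_append, List.map_cons, hone, htwo, hthree, List.map_nil,
    List.reverse_replicate, List.map_replicate, ← List.replicate_succ', hc₂] at hT hL hR
  rw [← List.append_assoc, hL, ← List.append_assoc, hR, hdr, List.replicate_succ] at hT
  have hn : ∀ k : List (Option S × A), none ∉ k.map some := by simp
  simp only [← List.map_append] at hT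
  obtain ⟨h1, h2⟩ := append_cons_inj_of_notMem (hn _) (by simp) hT
  obtain ⟨h2, -⟩ := append_cons_inj_of_notMem (hn _) (hn _) h2
  have h2 := List.map_injective_iff.2 (Option.some_injective _) h2
  have hl : l' = l.reverse := ruleItems_injective (by rw [h2, ruleItems, ruleItems, List.map_reverse])
  subst hl
  rw [List.reverse_reverse] at hp
  have h1 := List.map_injective_iff.2 (Option.some_injective _) h1
  have h3 := congrArg (List.map Prod.snd) h1
  refine QueueRules.eval_dom_of_path δ l s₀ _ e.reverse (by simp) hp ?_
  rw [List.map_append, hi₀', hil] at h3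
  simp only [List.nil_append] at h3
  rw [h3]
  simp [ruleItems, List.map_reverse, Function.comp_def]

/-- The symbol that records a letter and a state. -/
def cellOf (m : Bool) (i : Option S × A) : TapeSymbol (Sym S A) := .sym (.cell i.1 i.2 m)

theorem records_map_cellOf (m : Bool) (l : List (Option S × A)) : Records (l.map (cellOf m)) l := by
  simp [Records, cellOf, item, Function.comp_def]

theorem accepts_of_ctlNext {q q' : Ctl S} {x y : TapeSymbol (Sym S A)}
    {u v : List (TapeSymbol (Sym S A))} (h : ctlNext δ s₀ q x y = some q')
    (ha : (automaton δ s₀ a₀ n).Accepts (.inl q') ((upperMove (n := n) (.inl q')).shift (x :: u))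
      ((lowerMove (n := n) (.inl q')).shift (y :: v))) :
    (automaton δ s₀ a₀ n).Accepts (.inl q) (x :: u) (y :: v) :=
  .step (q' := .inl q') (by simp [automaton, next, h]) ha

theorem accepts_sim (l : List (S × A)) (o : Option S) {c d u v : List (TapeSymbol (Sym S A))}
    (hc : Records c (ruleItems l)) (hd : Records d (ruleItems l))
    (hp : δ.Path (some s₀) l.reverse o) (hu : u ≠ []) :
    (automaton δ s₀ a₀ n).Accepts (.inl (.sim o)) (c ++ .sym .junk :: u) (d ++ .leftEnd :: v) := by
  induction l generalizing o c d with
  | nil =>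
    obtain rfl := records_nil.1 hc
    obtain rfl := records_nil.1 hd
    obtain rfl : some s₀ = o := hp
    -- Entering `acc` advances the upper head, so a symbol has to follow the padding symbol.
    obtain ⟨x, u, rfl⟩ := List.exists_cons_of_ne_nil hu
    exact accepts_of_ctlNext (q' := .acc) (by simp [ctlNext]) (.here ..)
  | cons r l ih =>
    obtain ⟨b, c, rfl, hc'⟩ := records_cons.1 hc
    obtain ⟨b', d, rfl, hd'⟩ := records_cons.1 hd
    rw [List.reverse_cons, QueueRules.path_append_singleton] at hp
    exact accepts_of_ctlNext (q' := .sim (some r.1)) (by simp [ctlNext, hp.2]) (ih _ hc' hd' hp.1)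

theorem accepts_skip (e : List A) {d u v : List (TapeSymbol (Sym S A))} {r : S × A} {m : Bool}
    (hd : Records d (e.map fun a => (none, a)))
    (h : (automaton δ s₀ a₀ n).Accepts (.inl (.sim none)) u (cellOf m (some r.1, r.2) :: v)) :
    (automaton δ s₀ a₀ n).Accepts (.inl .skip) (.sym .mid :: u)
      (d ++ cellOf m (some r.1, r.2) :: v) := by
  induction e generalizing d with
  | nil =>
    obtain rfl := records_nil.1 hd
    exact accepts_of_ctlNext (q' := .sim none) rfl h
  | cons a e ih =>
    obtain ⟨b, d, rfl, hd'⟩ := records_cons.1 hd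
    exact accepts_of_ctlNext (q' := .skip) rfl (ih hd')

/-- The comparison with one rule, for the first rule (from `pad`, marked letter) and the later ones
(from `fst`, unmarked letter) at once. -/
theorem accepts_block {q : Ctl S} {m m' : Bool}
    (hq : ∀ o a s b, ctlNext δ s₀ q (.sym (.cell o a m)) (.sym (.cell (some s) b m')) =
      compareFst δ a (s, b)) {r : S × A} {k : List A} {t : Option S × A}
    {i : List (Option S × A)} {u v : List (TapeSymbol (Sym S A))}
    (hi : (t :: i).map Prod.snd = δ.written r ++ k)
    (h : ∀ i' : List (Option S × A), i'.map Prod.snd = k →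
      (automaton δ s₀ a₀ n).Accepts (.inl .fst) (i'.map (cellOf false) ++ u) v) :
    (automaton δ s₀ a₀ n).Accepts (.inl q) (cellOf m t :: (i.map (cellOf false) ++ u))
      (cellOf m' (some r.1, r.2) :: v) := by
  obtain ⟨h1, h2⟩ := List.cons.inj hi
  cases hb : (δ r.1 r.2).2.1 with
  | none =>
    refine accepts_of_ctlNext (q' := .fst) ?_ (h i (by simpa [hb] using h2))
    rw [cellOf, cellOf, hq]
    simp [compareFst, h1, hb]
  | some b =>
    refine accepts_of_ctlNext (q' := .snd) ?_ ?_
    · rw [cellOf, cellOf, hq]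
      simp [compareFst, h1, hb]
    · rw [hb] at h2
      cases i with
      | nil => simp at h2
      | cons t' i =>
        obtain ⟨h3, h4⟩ := List.cons.inj h2
        exact accepts_of_ctlNext (q' := .fst) (by simp [cellOf, ctlNext, hb, h3]) (h i h4)

theorem accepts_fst (l : List (S × A)) {i : List (Option S × A)}
    {d u v : List (TapeSymbol (Sym S A))} (hd : d = (ruleItems l).map (cellOf false))
    (hi : i.map Prod.snd = l.flatMap δ.written)
    (h : (automaton δ s₀ a₀ n).Accepts (.inl .skip) (.sym .mid :: u) v) :
    (automaton δ s₀ a₀ n).Accepts (.inl .fst) (i.map (cellOf false) ++ .sym .mid :: u)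
      (d ++ .sym .mid :: v) := by
  subst hd
  induction l generalizing i with
  | nil =>
    obtain rfl : i = [] := by simpa using hi
    exact accepts_of_ctlNext (q' := .skip) rfl h
  | cons r l ih =>
    cases i with
    | nil => simp [QueueRules.written] at hi
    | cons t i => exact accepts_block (fun _ _ _ _ => rfl) hi fun i' hi' => ih hi'

theorem accepts_pad (j : ℕ) {t : Option S × A} {u v : List (TapeSymbol (Sym S A))}
    (h : (automaton δ s₀ a₀ n).Accepts (.inl .pad) (cellOf true t :: u) v) :
    (automaton δ s₀ a₀ n).Accepts (.inl .pad) (cellOf true t :: u)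
      (List.replicate j (.sym .junk) ++ v) := by
  induction j with
  | zero => exact h
  | succ j ih =>
    rw [List.replicate_succ]
    exact accepts_of_ctlNext (q' := .pad) rfl ih

theorem accepts_chain {t : Option S × A} {u v : List (TapeSymbol (Sym S A))}
    (h : (automaton δ s₀ a₀ n).Accepts (.inl .pad) (cellOf true t :: u) v) (k : ℕ) (hk : k < n + 3)
    (c : List (TapeSymbol (Sym S A))) (hc : c.length = k)
    (hs : ∀ x ∈ c, chainSymbol a₀ x .rightEnd) :
    (automaton δ s₀ a₀ n).Accepts (.inr ⟨k, hk⟩) (c ++ cellOf true t :: u) (.rightEnd :: v) := by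
  induction k generalizing c with
  | zero =>
    obtain rfl := List.eq_nil_of_length_eq_zero hc
    exact .step (show next δ s₀ a₀ n (.inr ⟨0, hk⟩) (cellOf true t) .rightEnd =
      some (.inl .pad) from if_pos trivial) h
  | succ k ih =>
    obtain ⟨x, c, rfl⟩ := List.exists_cons_of_ne_nil (l := c) (by rintro rfl; simp at hc)
    refine .step (q' := .inr ⟨k, Nat.lt_of_succ_lt hk⟩) ?_ (ih _ c (by simpa using hc) fun y hy =>
      hs y (.tail _ hy))
    simp [automaton, next, hs x List.mem_cons_self]

theorem exists_accepts (h : (StateTransition.eval δ.step (s₀, List.replicate (n + 1) a₀)).Dom) :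
    ∃ p : List (Sym S A), ∀ j, (automaton δ s₀ a₀ n).Accepts (.inr (Fin.last (n + 2)))
      (tape (p ++ List.replicate (j + 1) .junk))
      (tape (p ++ List.replicate (j + 1) .junk)).reverse := by
  obtain ⟨l, e, hp, hl⟩ := QueueRules.exists_path_of_eval_dom δ s₀ _ (by simp) h
  obtain ⟨i₁, i₂, hi, hi₁, hi₂⟩ : ∃ i₁ i₂, ruleItems l ++ e.map (fun a => (none, a)) = i₁ ++ i₂ ∧
      i₁.map Prod.snd = List.replicate (n + 1) a₀ ∧ i₂.map Prod.snd = l.flatMap δ.written :=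
    List.map_eq_append_iff.1 (by rw [← hl]; simp [ruleItems, Function.comp_def])
  -- Halting needs at least one rule, which writes a letter; so there is a first written letter `t`
  -- to carry the mark.
  have hne : l ≠ [] := by
    rintro rfl
    cases hp
  obtain ⟨t, i₂, rfl⟩ : ∃ t i₃, i₂ = t :: i₃ := List.exists_cons_of_ne_nil (by
    rintro rfl
    obtain ⟨r, l, rfl⟩ := List.exists_cons_of_ne_nil hne
    simp [QueueRules.written] at hi₂)
  let f : Bool → Option S × A → Sym S A := fun m i => .cell i.1 i.2 m
  have hf : ∀ m, TapeSymbol.sym ∘ f m = cellOf m := fun m => rfl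
  have hrec : Records (i₁.map (cellOf false) ++ cellOf true t :: i₂.map (cellOf false)).reverse
      ((e.reverse.map fun a => (none, a)) ++ ruleItems l.reverse) := by
    have h1 := ((records_map_cellOf false i₁).append (records_cons.2
      ⟨true, _, rfl, records_map_cellOf false i₂⟩ : Records (cellOf true t :: _) _)).reverse
    rw [← hi] at h1
    simpa [ruleItems] using h1
  -- Seen from the right, the first block is the final queue followed by the reversed rules. The
  -- mark may lie in either part, so both are known only by what they record.
  obtain ⟨d, d', hdd, hd, hd'⟩ := List.map_eq_append_iff.1 (hrec.trans List.map_append)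
  refine ⟨i₁.map (f false) ++ f true t :: (i₂.map (f false) ++
    .mid :: (ruleItems l.reverse).map (f false)), fun j => ?_⟩
  have h1 : tape (i₁.map (f false) ++ f true t :: (i₂.map (f false) ++
      .mid :: (ruleItems l.reverse).map (f false)) ++ List.replicate (j + 1) .junk) =
      (.leftEnd :: i₁.map (cellOf false)) ++ cellOf true t :: (i₂.map (cellOf false) ++
        .sym .mid :: ((ruleItems l.reverse).map (cellOf false) ++
          .sym .junk :: (List.replicate j (.sym .junk) ++ [.rightEnd]))) := by
    simp [tape, List.replicate_succ, hf, cellOf, f]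
  have h2 : (tape (i₁.map (f false) ++ f true t :: (i₂.map (f false) ++
      .mid :: (ruleItems l.reverse).map (f false)) ++ List.replicate (j + 1) .junk)).reverse =
      .rightEnd :: (List.replicate (j + 1) (.sym .junk) ++ ((ruleItems l).map (cellOf false) ++
        .sym .mid :: (d ++ (d' ++ [.leftEnd])))) := by
    rw [← List.append_assoc d, ← hdd]
    simp [tape, hf, cellOf, f, ruleItems]
  rw [h2, h1]
  refine accepts_chain ?_ _ _ _ ?_ ?_
  · refine accepts_pad _ ?_
    have hskip : (automaton δ s₀ a₀ n).Accepts (.inl .skip)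
        (.sym .mid :: ((ruleItems l.reverse).map (cellOf false) ++
          .sym .junk :: (List.replicate j (.sym .junk) ++ [.rightEnd])))
        (d ++ (d' ++ [.leftEnd])) := by
      have hs := accepts_sim (δ := δ) (a₀ := a₀) (n := n) (s₀ := s₀) l.reverse none
        (u := List.replicate j (.sym .junk) ++ [.rightEnd]) (v := [])
        (records_map_cellOf false (ruleItems l.reverse)) hd' (by rwa [List.reverse_reverse])
        (by simp)
      obtain ⟨r, l', hr⟩ := List.exists_cons_of_ne_nil (l := l.reverse) (by simpa using hne)
      rw [hr] at hd'
      obtain ⟨m, d', rfl, -⟩ := records_cons.1 hd'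
      exact accepts_skip _ hd hs
    obtain ⟨r, l, rfl⟩ := List.exists_cons_of_ne_nil hne
    exact accepts_block (fun _ _ _ _ => rfl) hi₂ fun i' hi' => accepts_fst l rfl hi' hskip
  · simpa using congrArg List.length hi₁
  · intro x hx
    rcases List.mem_cons.1 hx with rfl | hx
    · trivial
    · obtain ⟨i, hi, rfl⟩ := List.mem_map.1 hx
      have := List.mem_map_of_mem (f := Prod.snd) hi
      rw [hi₁] at this
      exact List.eq_of_mem_replicate this

end QueueHistory

/-! ### Computability of the descriptions -/

namespace QueueHistory

open TwoHead
open Classical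

variable {S A : Type} (δ : QueueRules S A) (s₀ : S) (a₀ : A) {s k : ℕ}

/-- The numbering of the states of the history automaton. -/
def stateEquiv (e : Ctl S ≃ Fin k) (n : ℕ) : State S n ≃ Fin (k + (n + 3)) :=
  (Equiv.sumCongr e (Equiv.refl _)).trans finSumFinEquiv

/-- The history automaton as a Watson-Crick system. -/
noncomputable def system (eσ : Fin s ≃ Sym S A) (e : Ctl S ≃ Fin k) (n : ℕ) : DPWK s :=
  (automaton δ s₀ a₀ n).toDPWK eσ (stateEquiv e n)

variable {δ s₀ a₀} (eσ : Fin s ≃ Sym S A) (e : Ctl S ≃ Fin k)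

theorem isLinearREV_system (n : ℕ) : (system δ s₀ a₀ eσ e n).IsLinearREV :=
  (reversible δ s₀ a₀ n).isLinearREV _ _

theorem mem_language_system_iff (n : ℕ) (w : List (Fin s)) :
    w ∈ (system δ s₀ a₀ eσ e n).language ↔
      (automaton δ s₀ a₀ n).Accepts (.inr (Fin.last (n + 2))) (tape (w.map eσ))
        (tape (w.map eσ)).reverse :=
  (reversible δ s₀ a₀ n).mem_language_iff _ _ w

theorem language_system_eq_empty {n : ℕ}
    (h : ¬ (StateTransition.eval δ.step (s₀, List.replicate (n + 1) a₀)).Dom) :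
    (system δ s₀ a₀ eσ e n).language = ∅ :=
  Set.eq_empty_of_forall_notMem fun w hw =>
    h (eval_dom_of_spec _ (spec_of_accepts ((mem_language_system_iff eσ e n w).1 hw)))

theorem language_system_infinite {n : ℕ}
    (h : (StateTransition.eval δ.step (s₀, List.replicate (n + 1) a₀)).Dom) :
    (system δ s₀ a₀ eσ e n).language.Infinite := by
  obtain ⟨p, hp⟩ := exists_accepts h
  refine Set.infinite_of_injective_forall_mem
    (f := fun j : ℕ => (p ++ List.replicate (j + 1) Sym.junk).map eσ.symm) (fun i j hij => ?_)
    fun j => ?_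
  · simpa using congrArg List.length hij
  · rw [mem_language_system_iff, List.map_map, Equiv.self_comp_symm, List.map_id]
    exact hp j

/-- The entry of a transition table. -/
def entry {n : ℕ} (d : State S n → Move) (o : Option (State S n)) : Option (ℕ × ℕ) :=
  o.map fun q => ((stateEquiv e n q).val, (d q).toNat)

/-- These rows belong to the control states and to the last chain state, numbered `k`. Their entries
lead to control states, whose numbers do not depend on `n`. -/
theorem entry_next_of_lt (d : ∀ n, State S n → Move) (hd : ∀ n c, d n (.inl c) = d 0 (.inl c))
    {n i : ℕ} (hi : i < k + 1) (x y : TapeSymbol (Sym S A)) :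
    entry e (d n) (next δ s₀ a₀ n ((stateEquiv e n).symm ⟨i, by omega⟩) x y) =
      entry e (d 0) (next δ s₀ a₀ 0 ((stateEquiv e 0).symm ⟨i, by omega⟩) x y) := by
  rcases Nat.lt_succ_iff_lt_or_eq.1 hi with hi | rfl
  · have h : ∀ n, (stateEquiv e n).symm ⟨i, by omega⟩ = .inl (e.symm ⟨i, hi⟩) := fun n => by
      rw [Equiv.symm_apply_eq]
      exact Fin.ext (by simp [stateEquiv])
    rw [h, h]
    simp [next, entry, stateEquiv, Function.comp_def, hd n]
  · have h : ∀ n, (stateEquiv e n).symm ⟨i, by omega⟩ = .inr ⟨0, by omega⟩ := fun n => by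
      rw [Equiv.symm_apply_eq]
      exact Fin.ext (by simp [stateEquiv])
    rw [h, h]
    simp only [next, entry]
    split_ifs
    · simp [stateEquiv, hd n]
    · rfl

/-- A chain state leads to the next lower one, and the order of the chain is kept by the numbering;
hence the target `i - 1`. -/
theorem entry_next_of_le (d : ∀ n, State S n → Move) (m : Move) (hd : ∀ n i, d n (.inr i) = m)
    {n i : ℕ} (hi : k + 1 ≤ i) (hi' : i < k + (n + 3)) (x y : TapeSymbol (Sym S A)) :
    entry e (d n) (next δ s₀ a₀ n ((stateEquiv e n).symm ⟨i, hi'⟩) x y) =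
      if chainSymbol a₀ x y then some (i - 1, m.toNat) else none := by
  obtain ⟨j, rfl⟩ := Nat.exists_eq_add_of_le hi
  have h : (stateEquiv e n).symm ⟨k + 1 + j, hi'⟩ = .inr ⟨j + 1, by omega⟩ := by
    rw [Equiv.symm_apply_eq]
    exact Fin.ext (by simp [stateEquiv]; omega)
  rw [h]
  simp only [next, entry]
  split_ifs
  · simp [stateEquiv, hd n]
  · rfl

/-- A transition table that is determined by its first rows and by a pattern for the other ones. -/
def tableOf {α β : Type} (T : List (List (List (Option (ℕ × ℕ))))) (X : List α) (Y : List β)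
    (c : α → β → Bool) (m N : ℕ) : List (List (List (Option (ℕ × ℕ)))) :=
  (List.range N).map fun i => (T[i]?).getD
    (X.map fun x => Y.map fun y => bif c x y then some (i - 1, m) else none)

/-- Nothing is asked of `c`: its finitely many values on `X` and `Y` form a constant list, and only
the row number varies. -/
theorem primrec_tableOf {α β : Type} (T : List (List (List (Option (ℕ × ℕ))))) (X : List α)
    (Y : List β) (c : α → β → Bool) (m : ℕ) : Primrec (tableOf T X Y c m) := by
  have h1 : Primrec₂ fun (i : ℕ) (b : Bool) =>
      (bif b then some (i - 1, m) else none : Option (ℕ × ℕ)) :=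
    Primrec.cond Primrec.snd (Primrec.option_some.comp (Primrec.pair
      (Primrec.nat_sub.comp Primrec.fst (Primrec.const 1)) (Primrec.const m))) (Primrec.const none)
  have h2 : Primrec₂ fun (i : ℕ) (l : List Bool) =>
      l.map fun b => (bif b then some (i - 1, m) else none : Option (ℕ × ℕ)) :=
    Primrec.list_map Primrec.snd (h1.comp₂ (Primrec.fst.comp₂ Primrec₂.left) Primrec₂.right)
  have h3 : Primrec fun i : ℕ => (X.map fun x => Y.map fun y => c x y).map fun l =>
      l.map fun b => (bif b then some (i - 1, m) else none : Option (ℕ × ℕ)) :=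
    Primrec.list_map (Primrec.const _) h2
  have h4 : Primrec fun i : ℕ => (T[i]?).getD ((X.map fun x => Y.map fun y => c x y).map fun l =>
      l.map fun b => (bif b then some (i - 1, m) else none : Option (ℕ × ℕ))) :=
    Primrec.option_getD.comp (Primrec.list_getElem?.comp (Primrec.const T) Primrec.id) h3
  refine (Primrec.list_map Primrec.list_range (h4.comp₂ Primrec₂.right)).of_eq fun N => ?_
  simp [tableOf, Function.comp_def]

theorem table_eq_tableOf {α β : Type} (X : List α) (Y : List β) (c : α → β → Bool) (m k : ℕ)
    (r : ∀ n, Fin (k + (n + 3)) → α → β → Option (ℕ × ℕ))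
    (h1 : ∀ n i, ∀ hi : i < k + 1, ∀ x y,
      r n ⟨i, by omega⟩ x y = r 0 ⟨i, by omega⟩ x y)
    (h2 : ∀ n i, ∀ hi : i < k + (n + 3), k + 1 ≤ i → ∀ x y,
      r n ⟨i, hi⟩ x y = bif c x y then some (i - 1, m) else none) (n : ℕ) :
    ((List.finRange (k + (n + 3))).map fun q => X.map fun x => Y.map fun y => r n q x y) =
      tableOf ((List.finRange (k + 1)).map fun i : Fin (k + 1) =>
        X.map fun x => Y.map fun y => r 0 ⟨i.val, by omega⟩ x y) X Y c m (k + (n + 3)) := by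
  refine List.ext_getElem (by simp [tableOf]) fun i hi _ => ?_
  have hi' : i < k + (n + 3) := by simpa using hi
  simp only [tableOf, List.getElem_map, List.getElem_finRange, List.getElem_range]
  by_cases h : i < k + 1
  · rw [List.getElem?_eq_getElem (by simpa using h)]
    simp [h1 n i h]
  · rw [List.getElem?_eq_none (by simpa using h)]
    simp [h2 n i hi' (by omega)]

/-- The description of a component that is determined by a transition table. -/
def componentCodeOf (a : ℕ) (B : List (Option ℕ)) (k n : ℕ)
    (T : List (List (List (Option (ℕ × ℕ))))) : ComponentCode :=
  (k + (n + 3), k + (n + 2), (List.range (k + (n + 3))).map fun q => decide (q = a),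
    (List.range (k + (n + 3))).map fun _ => B, T)

theorem primrec_componentCodeOf (a : ℕ) (B : List (Option ℕ)) (k : ℕ)
    {T : ℕ → List (List (List (Option (ℕ × ℕ))))} (hT : Primrec T) :
    Primrec fun n => componentCodeOf a B k n (T (k + (n + 3))) := by
  have h : ∀ j, Primrec fun n : ℕ => k + (n + j) := fun j =>
    Primrec.nat_add.comp (Primrec.const k) (Primrec.nat_add.comp Primrec.id (Primrec.const j))
  have h3 := Primrec.list_range.comp (h 3)
  exact (h 3).pair ((h 2).pair ((Primrec.list_map h3
    (Primrec.eq.decide.comp₂ Primrec₂.right (Primrec₂.const a))).pair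
      ((Primrec.list_map h3 (Primrec₂.const B)).pair (hT.comp (h 3)))))

theorem exists_component_code {C : ∀ n, Component (Fin s) (Fin (s + 2)) (Fin (k + (n + 3)))}
    (hstart : ∀ n, (C n).start.val = k + (n + 2)) (a : ℕ)
    (haccept : ∀ n q, q ∈ (C n).accept ↔ q.val = a)
    (hb : ∀ n q x, (C n).broadcast q x = some x.toFin)
    (c : TapeSymbol (Fin s) → Option (Fin (s + 2)) → Bool) (m : ℕ)
    (h1 : ∀ n i, ∀ hi : i < k + 1, ∀ x y,
      ((C n).trans ⟨i, by omega⟩ x y).map (fun r => (r.1.val, r.2.toNat)) =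
        ((C 0).trans ⟨i, by omega⟩ x y).map (fun r => (r.1.val, r.2.toNat)))
    (h2 : ∀ n i, ∀ hi : i < k + (n + 3), k + 1 ≤ i → ∀ x y,
      ((C n).trans ⟨i, hi⟩ x y).map (fun r => (r.1.val, r.2.toNat)) =
        bif c x y then some (i - 1, m) else none) :
    Primrec fun n => (C n).code := by
  refine (primrec_componentCodeOf a ((allTapeSymbols s).map fun x => some x.toFin.val) k
    (primrec_tableOf ((List.finRange (k + 1)).map fun i : Fin (k + 1) => (allTapeSymbols s).map fun x =>
      (allMessages (s + 2)).map fun y => ((C 0).trans ⟨i.val, by omega⟩ x y).map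
        (fun r => (r.1.val, r.2.toNat))) (allTapeSymbols s) (allMessages (s + 2)) c m)).of_eq
    fun n => ?_
  rw [componentCodeOf, Component.code, hstart]
  congr 3
  · rw [← List.map_coe_finRange_eq_range, List.map_map]
    exact List.map_congr_left fun q _ => by simp [haccept]
  · congr 1
    · rw [← List.map_coe_finRange_eq_range, List.map_map]
      exact List.map_congr_left fun q _ => List.map_congr_left fun x _ => by simp [hb]
    · exact (table_eq_tableOf _ _ c m k (fun n q x y => ((C n).trans q x y).map
        (fun r => (r.1.val, r.2.toNat))) h1 h2 n).symm

theorem map_nextFin {n : ℕ} (d : State S n → Move) (q : Fin (k + (n + 3)))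
    (x y : TapeSymbol (Fin s)) :
    (((automaton δ s₀ a₀ n).nextFin eσ (stateEquiv e n) q x y).map
      fun q' => (q', d ((stateEquiv e n).symm q'))).map (fun r => (r.1.val, r.2.toNat)) =
      entry e d (next δ s₀ a₀ n ((stateEquiv e n).symm q) (x.map eσ) (y.map eσ)) := by
  simp only [nextFin, entry, Option.map_map, automaton]
  congr 1
  funext q'
  simp

theorem primrec_code_system : Primrec fun n => (system δ s₀ a₀ eσ e n).code := by
  have hstart : ∀ n, (stateEquiv e n (.inr (Fin.last (n + 2)))).val = k + (n + 2) := fun n => by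
    simp [stateEquiv]
  have haccept : ∀ n q, q ∈ ({stateEquiv e n (.inl .acc)} : Finset (Fin (k + (n + 3)))) ↔
      q.val = (e .acc).val := fun n q => by
    rw [Finset.mem_singleton, Fin.ext_iff]
    simp [stateEquiv]
  have hu : Primrec fun n => (system δ s₀ a₀ eσ e n).upper.code := by
    refine exists_component_code (C := fun n => (system δ s₀ a₀ eσ e n).upper) hstart _ haccept
      (fun _ _ _ => rfl) (fun x a => a.elim false fun a =>
        decide (chainSymbol a₀ (x.map eσ) ((TapeSymbol.ofFin a).map eσ))) 1
      (fun n i hi x a => ?_) (fun n i hi hi' x a => ?_)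
    · cases a with
      | none => rfl
      | some a =>
        exact (map_nextFin eσ e upperMove _ x _).trans
          ((entry_next_of_lt e (fun n => upperMove (n := n)) (fun _ c => by
            rcases c with _ | _ | _ | _ | _ | (_ | _) <;> rfl) hi _ _).trans
            (map_nextFin eσ e upperMove _ x _).symm)
    · cases a with
      | none => rfl
      | some a =>
        refine (map_nextFin eσ e upperMove _ x _).trans
          ((entry_next_of_le e (fun n => upperMove (n := n)) .advance (fun _ _ => rfl) hi' hi _
            _).trans ?_)
        simp [Bool.cond_decide, Move.toNat]
  have hl : Primrec fun n => (system δ s₀ a₀ eσ e n).lower.code := by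
    refine exists_component_code (C := fun n => (system δ s₀ a₀ eσ e n).lower) hstart _ haccept
      (fun _ _ _ => rfl) (fun y a => a.elim false fun a =>
        decide (chainSymbol a₀ ((TapeSymbol.ofFin a).map eσ) (y.map eσ))) 0
      (fun n i hi y a => ?_) (fun n i hi hi' y a => ?_)
    · cases a with
      | none => rfl
      | some a =>
        exact (map_nextFin eσ e lowerMove _ _ y).trans
          ((entry_next_of_lt e (fun n => lowerMove (n := n)) (fun _ c => by
            rcases c with _ | _ | _ | _ | _ | (_ | _) <;> rfl) hi _ _).trans
            (map_nextFin eσ e lowerMove _ _ y).symm)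
    · cases a with
      | none => rfl
      | some a =>
        refine (map_nextFin eσ e lowerMove _ _ y).trans
          ((entry_next_of_le e (fun n => lowerMove (n := n)) .stay (fun _ _ => rfl) hi' hi _
            _).trans ?_)
        simp [Bool.cond_decide, Move.toNat]
  exact (Primrec.const s).pair ((Primrec.const (s + 2)).pair (hu.pair hl))

end QueueHistory

/-! ### A system for the empty language -/

namespace TwoHead

/-- An automaton that accepts no input. -/
def empty (σ : Type) : TwoHead σ Bool where
  next _ _ _ := none
  move₁ _ := .advance
  move₂ _ := .advance
  start := false
  accept := true

theorem reversible_empty (σ : Type) : (empty σ).Reversible where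
  injective h := by cases h
  moves _ := .inl rfl
  next_accept _ _ := rfl

theorem exists_language_eq_empty (s : ℕ) : ∃ B : DPWK s, B.IsLinearREV ∧ B.language = ∅ := by
  refine ⟨(empty (Fin s)).toDPWK (.refl _) finTwoEquiv.symm, (reversible_empty _).isLinearREV _ _,
    Set.eq_empty_of_forall_notMem fun w hw => ?_⟩
  have h := ((reversible_empty _).mem_language_iff _ _ w).1 hw
  have key : ∀ q u v, (empty (Fin s)).Accepts q u v → q = true := fun q u v h => by
    cases h with
    | here => rfl
    | step h => cases h
  exact Bool.false_ne_true (key _ _ _ h)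

end TwoHead

/-! ### The reductions from the complement of the halting problem -/

/-- Watson-Crick systems for which the language is infinite or empty, depending on whether a
partial recursive function is defined. -/
theorem exists_family_DPWK :
    ∃ (s : ℕ) (F : ℕ → DPWK s), Computable (fun n => (F n).code) ∧ (∀ n, (F n).IsLinearREV) ∧
      (∀ n, ((Denumerable.ofNat Nat.Partrec.Code n).eval 0).Dom → (F n).language.Infinite) ∧
      ∀ n, ¬ ((Denumerable.ofNat Nat.Partrec.Code n).eval 0).Dom → (F n).language = ∅ := by
  obtain ⟨S, A, _, _, δ, s₀, a₀, h⟩ := exists_queueMachine_dom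
  obtain ⟨s, ⟨eσ⟩⟩ := Finite.exists_equiv_fin (QueueHistory.Sym S A)
  obtain ⟨k, ⟨e⟩⟩ := Finite.exists_equiv_fin (QueueHistory.Ctl S)
  exact ⟨s, QueueHistory.system δ s₀ a₀ eσ.symm e,
    (QueueHistory.primrec_code_system eσ.symm e).to_comp,
    fun n => QueueHistory.isLinearREV_system eσ.symm e n,
    fun n hn => QueueHistory.language_system_infinite eσ.symm e ((h n).2 hn),
    fun n hn => QueueHistory.language_system_eq_empty eσ.symm e fun hd => hn ((h n).1 hd)⟩

/-- The complement of the halting problem is not reducible to a semidecidable problem. -/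
theorem not_semidecidableOn_of_reduction {α ι : Type} [Primcodable ι] {code : α → ι}
    {inst yes : α → Prop} (f : ℕ → α) (hf : Computable fun n => code (f n))
    (hi : ∀ n, inst (f n))
    (hy : ∀ n, yes (f n) ↔ ¬ ((Denumerable.ofNat Nat.Partrec.Code n).eval 0).Dom) :
    ¬ SemidecidableOn code inst yes := by
  rintro ⟨P, hP, h⟩
  refine ComputablePred.halting_problem_not_re 0 ?_
  have hc : Partrec fun c : Nat.Partrec.Code =>
      Part.assert (P (code (f (Encodable.encode c)))) fun _ => Part.some () :=
    Partrec.comp hP (hf.comp Computable.encode)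
  refine REPred.of_eq (p := fun c : Nat.Partrec.Code => P (code (f (Encodable.encode c)))) hc
    fun c => ?_
  rw [h _ (hi _), hy, Denumerable.ofNat_encode]

theorem mainTheorem11 :
    -- emptiness
    (¬ SemidecidableOn (fun A : (s : ℕ) × DPWK s => A.2.code)
        (fun A => A.2.IsLinearREV)
        (fun A => A.2.language = ∅)) ∧
    -- finiteness
    (¬ SemidecidableOn (fun A : (s : ℕ) × DPWK s => A.2.code)
        (fun A => A.2.IsLinearREV)
        (fun A => A.2.language.Finite)) ∧
    -- inclusion
    (¬ SemidecidableOn (fun A : (s : ℕ) × DPWK s × DPWK s => (A.2.1.code, A.2.2.code))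
        (fun A => A.2.1.IsLinearREV ∧ A.2.2.IsLinearREV)
        (fun A => A.2.1.language ⊆ A.2.2.language)) ∧
    -- equivalence
    (¬ SemidecidableOn (fun A : (s : ℕ) × DPWK s × DPWK s => (A.2.1.code, A.2.2.code))
        (fun A => A.2.1.IsLinearREV ∧ A.2.2.IsLinearREV)
        (fun A => A.2.1.language = A.2.2.language)) := by
  obtain ⟨s, F, hF, hrev, hinf, hempty⟩ := exists_family_DPWK
  obtain ⟨B, hB, hBe⟩ := TwoHead.exists_language_eq_empty s
  have hpair : Computable fun n => ((F n).code, B.code) := hF.pair (Computable.const B.code)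
  have he : ∀ n, (F n).language = ∅ ↔ ¬ ((Denumerable.ofNat Nat.Partrec.Code n).eval 0).Dom :=
    fun n => ⟨fun h hd => (hinf n hd).nonempty.ne_empty h, hempty n⟩
  refine ⟨?_, ?_, ?_, ?_⟩
  · exact not_semidecidableOn_of_reduction (fun n => ⟨s, F n⟩) hF hrev he
  · refine not_semidecidableOn_of_reduction (fun n => ⟨s, F n⟩) hF hrev fun n =>
      ⟨fun h hd => hinf n hd h, fun h => ?_⟩
    rw [hempty n h]
    exact Set.finite_empty
  · refine not_semidecidableOn_of_reduction (fun n => ⟨s, F n, B⟩) hpair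
      (fun n => ⟨hrev n, hB⟩) fun n => ?_
    rw [← he, hBe, Set.subset_empty_iff]
  · refine not_semidecidableOn_of_reduction (fun n => ⟨s, F n, B⟩) hpair
      (fun n => ⟨hrev n, hB⟩) fun n => ?_
    rw [← he, hBe]
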